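/- Let $\mathsf{gr}$ (resp. $\mathsf{ab}$) be the category of finitely generated free groups (resp. finitely generated free abelian groups) and all homomorphisms, let $\mathcal F(\mathsf{gr};\mathbb Z)$ and $\mathcal F(\mathsf{ab};\mathbb Z)$ be the abelian categories of functors from $\mathsf{gr}$, resp. $\mathsf{ab}$, to the category $\mathsf{Ab}$ of abelian groups, let $I:\mathsf{ab}\to\mathsf{Ab}$ be the inclusion, $S^d:\mathsf{ab}\to\mathsf{Ab}$ the $d$-th symmetric power functor over $\mathbb Z$, and $\mathfrak a$ the abelianization functor $G\mapsto G/[G,G]$, regarded both as a functor $\mathsf{gr}\to\mathsf{ab}$ and, after composing with $I$, as an object of $\mathcal F(\mathsf{gr};\mathbb Z)$. (1) For every integer $d\ge 1$, the exact functor $-\circ\mathfrak a:\mathcal F(\mathsf{ab};\mathbb Z)\to\mathcal F(\mathsf{gr};\mathbb Z)$ induces an isomorphism $$\mathrm{Ext}^1_{\mathcal F(\mathsf{ab};\mathbb Z)}(I,S^d)\xrightarrow{\ \cong\ }\mathrm{Ext}^1_{\mathcal F(\mathsf{gr};\mathbb Z)}(\mathfrak a,S^d\circ\mathfrak a).$$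 (2) Let $p$ be a prime, $l\ge1$ an integer and $d=p^l$. Let $E_d:\mathsf{ab}\to\mathsf{Ab}$ be the functor, unique up to isomorphism, with $E_d(\mathbb Z^n)=S^d(\mathbb Z^n)\oplus\mathbb Z^n$ for all $n\ge0$ and $$E_d(g)=\begin{pmatrix}S^d(g)&D_d(g)\\0&g\end{pmatrix}$$ for every $g=\mathrm{id}_{\mathbb Z^n}\oplus f\oplus\mathrm{id}_{\mathbb Z^m}$ ($n,m\ge0$), where $f$ is one of the following generating morphisms: the switch $\mathbb Z^2\to\mathbb Z^2$, the addition $\mathbb Z^2\to\mathbb Z$, the diagonal $\Delta:\mathbb Z\to\mathbb Z^2$, the maps $\mathbb Z\to0$ and $0\to\mathbb Z$, and $-\mathrm{id}:\mathbb Z\to\mathbb Z$. Here $D_d(g)$ sends $e_{n+1}$ to $\sum_{k=1}^{d-1}\frac1p\binom{d}{k}e_{n+1}^ke_{n+2}^{d-k}$ if $f=\Delta$ and to $\frac{1+(-1)^d}{p}e_{n+1}^d$ if $f=-\mathrm{id}$, it sends the other basis vectors to $0$ in these two cases, and $D_d(g)=0$ in the other cases. Then the sequence $$0\to S^d\circ\mathfrak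 a\to E_d\circ\mathfrak a\to\mathfrak a\to0$$ in $\mathcal F(\mathsf{gr};\mathbb Z)$ given by the inclusion of the first and the projection to the second summand is exact, its class generates $\mathrm{Ext}^1_{\mathcal F(\mathsf{gr};\mathbb Z)}(\mathfrak a,S^d\circ\mathfrak a)$, and this group is isomorphic to $\mathbb Z/p$. -/

import Mathlib

open CategoryTheory CategoryTheory.Abelian

namespace FunctorExt

/-! ### The categories `gr` and `ab`, abelianization, and functor categories -/

/-- A group is an object of `gr` when it is free and finitely generated. -/
def isFGFreeGroup : ObjectProperty GrpCat.{0} := fun G => IsFreeGroup G ∧ Group.FG G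

/-- An abelian group is an object of `ab` when it is free abelian and finitely generated. -/
def isFGFreeAb : ObjectProperty AddCommGrpCat.{0} :=
  fun A => Module.Free ℤ A ∧ Module.Finite ℤ A

/-- The category `gr` of finitely generated free groups and group homomorphisms. -/
abbrev Gr : Type 1 := isFGFreeGroup.FullSubcategory

/-- The category `ab` of finitely generated free abelian groups and homomorphisms. -/
abbrev Ab : Type 1 := isFGFreeAb.FullSubcategory

/-- The category `F(gr; ℤ)` of functors from `gr` to abelian groups. -/
abbrev FGr := Gr ⥤ AddCommGrpCat.{0}

/-- The category `F(ab; ℤ)` of functors from `ab` to abelian groups. -/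
abbrev FAb := Ab ⥤ AddCommGrpCat.{0}

instance : HasExt.{1} FGr := HasExt.standard _

instance : HasExt.{1} FAb := HasExt.standard _

theorem isFGFreeAb_abelianize (G : Gr) :
    isFGFreeAb ((GrpCat.abelianize ⋙ CommGrpCat.toAddCommGrp).obj G.obj) := by
  obtain ⟨h1, h2⟩ := G.property
  constructor
  · obtain ⟨ι, ⟨b⟩⟩ := h1.nonempty_basis
    let e : FreeAbelianGroup ι ≃+ Additive (Abelianization G.obj) :=
      MulEquiv.toAdditive b.repr.symm.abelianizationCongr
    exact Module.Free.of_basis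
      ((FreeAbelianGroup.basis ι).map e.toIntLinearEquiv)
  · have : Group.FG (Abelianization G.obj) :=
      Group.fg_of_surjective (f := Abelianization.of (G := G.obj))
        QuotientGroup.mk_surjective
    exact Module.Finite.iff_addGroup_fg.mpr
      (inferInstanceAs (AddGroup.FG (Additive (Abelianization G.obj))))

/-- The abelianization functor `gr ⥤ ab`, `G ↦ G / [G, G]`. -/
def abelianization : Gr ⥤ Ab :=
  isFGFreeAb.lift (isFGFreeGroup.ι ⋙ GrpCat.abelianize ⋙ CommGrpCat.toAddCommGrp)
    isFGFreeAb_abelianize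

/-- The inclusion functor `I : ab ⥤ Ab`. -/
def I : FAb := isFGFreeAb.ι

/-- Precomposition with abelianization, `F(ab; ℤ) ⥤ F(gr; ℤ)`. -/
abbrev precompAbelianization : FAb ⥤ FGr :=
  (Functor.whiskeringLeft Gr Ab AddCommGrpCat.{0}).obj abelianization

/-- The abelianization functor `𝔞 : gr ⥤ Ab` with values in all abelian groups. -/
abbrev 𝔞 : FGr := abelianization ⋙ I

/-! ### Symmetric powers -/

section Sym

variable {A B C : Type} [AddCommGroup A] [AddCommGroup B] [AddCommGroup C]

/-- The `d`-th symmetric power of an abelian group, as the degree `d` part of its symmetric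
algebra over `ℤ`: the span of the products of `d` elements of `A`. -/
noncomputable def symPow (d : ℕ) (A : Type) [AddCommGroup A] :
    Submodule ℤ (SymmetricAlgebra ℤ A) :=
  LinearMap.range (SymmetricAlgebra.ι ℤ A) ^ d

/-- The ring homomorphism of symmetric algebras induced by a homomorphism of abelian groups. -/
noncomputable def symMap (f : A →+ B) : SymmetricAlgebra ℤ A →ₐ[ℤ] SymmetricAlgebra ℤ B :=
  SymmetricAlgebra.lift (SymmetricAlgebra.ι ℤ B ∘ₗ f.toIntLinearMap)

theorem symMap_ι (f : A →+ B) (a : A) :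
    symMap f (SymmetricAlgebra.ι ℤ A a) = SymmetricAlgebra.ι ℤ B (f a) := by
  simp [symMap]

theorem symMap_id : symMap (AddMonoidHom.id A) = AlgHom.id ℤ _ := by
  apply SymmetricAlgebra.algHom_ext
  ext a
  simp [symMap_ι]

theorem symMap_comp (g : B →+ C) (f : A →+ B) :
    symMap (g.comp f) = (symMap g).comp (symMap f) := by
  apply SymmetricAlgebra.algHom_ext
  ext a
  simp [symMap_ι]

theorem symMap_mem (d : ℕ) (f : A →+ B) {x : SymmetricAlgebra ℤ A} (hx : x ∈ symPow d A) :
    symMap f x ∈ symPow d B := by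
  have h : (symPow d A).map (symMap f).toLinearMap ≤ symPow d B := by
    unfold symPow
    rw [Submodule.map_pow]
    refine pow_le_pow_left' ?_ d
    rintro _ ⟨_, ⟨a, rfl⟩, rfl⟩
    change symMap f (SymmetricAlgebra.ι ℤ A a) ∈ _
    rw [symMap_ι]
    exact LinearMap.mem_range_self _ _
  exact h ⟨x, hx, rfl⟩

theorem ι_pow_mem (d : ℕ) (a : A) : SymmetricAlgebra.ι ℤ A a ^ d ∈ symPow d A :=
  Submodule.pow_mem_pow _ (LinearMap.mem_range_self _ a) d

theorem ι_pow_mul_ι_pow_mem {d k : ℕ} (hk : k ≤ d) (a b : A) :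
    SymmetricAlgebra.ι ℤ A a ^ k * SymmetricAlgebra.ι ℤ A b ^ (d - k) ∈ symPow d A := by
  have := Submodule.mul_mem_mul (ι_pow_mem k a) (ι_pow_mem (d - k) b)
  unfold symPow at this ⊢
  rwa [← pow_add, Nat.add_sub_cancel' hk] at this

/-- The homomorphism `S^d(f) : S^d(A) → S^d(B)` induced by `f : A → B`. -/
noncomputable def symPowMap (d : ℕ) (f : A →+ B) : symPow d A →+ symPow d B :=
  ((symMap f).toLinearMap.restrict (fun _ hx => symMap_mem d f hx)).toAddMonoidHom

@[simp]
theorem coe_symPowMap (d : ℕ) (f : A →+ B) (x : symPow d A) :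
    (symPowMap d f x : SymmetricAlgebra ℤ B) = symMap f x := rfl

end Sym

/-- The `d`-th symmetric power functor `S^d : ab ⥤ Ab`. -/
noncomputable def S (d : ℕ) : FAb where
  obj V := AddCommGrpCat.of (symPow d V.obj)
  map f := AddCommGrpCat.ofHom (symPowMap d f.hom.hom)
  map_id V := by
    ext x
    exact DFunLike.congr_fun symMap_id (x : SymmetricAlgebra ℤ V.obj)
  map_comp f g := by
    ext x
    exact DFunLike.congr_fun (symMap_comp g.hom.hom f.hom.hom) (x : SymmetricAlgebra ℤ _)

/-! ### The functor `E_d` for `d = p ^ l` -/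

section Ed

variable {A B C : Type} [AddCommGroup A] [AddCommGroup B] [AddCommGroup C]

/-- The element `∑_{0 < k < d} (1 / p) (d choose k) a ^ k b ^ (d - k)` of `S^d(A)`; the
coefficients are integers when `d = p ^ l` with `p` prime. -/
noncomputable def mixed (p d : ℕ) (a b : A) : symPow d A :=
  ⟨∑ k ∈ Finset.Ioo 0 d, (d.choose k / p) •
      (SymmetricAlgebra.ι ℤ A a ^ k * SymmetricAlgebra.ι ℤ A b ^ (d - k)),
    Submodule.sum_mem _ fun _ hk => Submodule.smul_of_tower_mem _ _
      (ι_pow_mul_ι_pow_mem (Finset.mem_Ioo.mp hk).2.le a b)⟩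

theorem ι_add_pow (p l : ℕ) [hp : Fact p.Prime] (a b : A) :
    SymmetricAlgebra.ι ℤ A (a + b) ^ (p ^ l) =
      SymmetricAlgebra.ι ℤ A a ^ (p ^ l) + SymmetricAlgebra.ι ℤ A b ^ (p ^ l) +
        p • (mixed p (p ^ l) a b : SymmetricAlgebra ℤ A) := by
  have hd : 0 < p ^ l := pow_pos hp.out.pos l
  have h1 : Finset.range (p ^ l + 1) = insert 0 (insert (p ^ l) (Finset.Ioo 0 (p ^ l))) := by
    ext k
    simp only [Finset.mem_range, Finset.mem_insert, Finset.mem_Ioo]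
    omega
  rw [map_add, add_pow, h1, Finset.sum_insert (by simp [hd.ne]), Finset.sum_insert (by simp),
    mixed, Finset.smul_sum]
  have h2 : ∀ k ∈ Finset.Ioo 0 (p ^ l),
      SymmetricAlgebra.ι ℤ A a ^ k * SymmetricAlgebra.ι ℤ A b ^ (p ^ l - k) *
        ((p ^ l).choose k : SymmetricAlgebra ℤ A) =
      p • (((p ^ l).choose k / p) •
        (SymmetricAlgebra.ι ℤ A a ^ k * SymmetricAlgebra.ι ℤ A b ^ (p ^ l - k))) := by
    intro k hk
    obtain ⟨hk0, hk1⟩ := Finset.mem_Ioo.mp hk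
    have hdvd : p ∣ (p ^ l).choose k := hp.out.dvd_choose_pow hk0.ne' hk1.ne
    rw [smul_smul, Nat.mul_div_cancel' hdvd, nsmul_eq_mul, mul_comm]
  rw [Finset.sum_congr rfl h2]
  simp only [pow_zero, one_mul, Nat.sub_zero, Nat.choose_zero_right, Nat.cast_one, mul_one,
    Nat.sub_self, Nat.choose_self]
  abel

/-- The group `E_d(A)` for `d = p ^ l`: the pairs `(x, a)` in `S^d(A) × A` with
`x ≡ a ^ d` modulo `p S^d(A)`. On `A = ℤⁿ` it is identified with `S^d(ℤⁿ) ⊕ ℤⁿ` in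
`EdCoord` below. -/
def EdGroup (p l : ℕ) [hp : Fact p.Prime] (A : Type) [AddCommGroup A] :
    AddSubgroup (symPow (p ^ l) A × A) where
  carrier := {z | ∃ y : symPow (p ^ l) A,
    (z.1 : SymmetricAlgebra ℤ A) =
      SymmetricAlgebra.ι ℤ A z.2 ^ (p ^ l) + p • (y : SymmetricAlgebra ℤ A)}
  zero_mem' := ⟨0, by simp [hp.out.ne_zero]⟩
  add_mem' := by
    rintro ⟨x, a⟩ ⟨x', a'⟩ ⟨y, hy⟩ ⟨y', hy'⟩
    refine ⟨y + y' - mixed p (p ^ l) a a', ?_⟩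
    simp only at hy hy'
    simp only [Prod.mk_add_mk, Submodule.coe_add, Submodule.coe_sub, hy, hy', ι_add_pow, smul_add,
      smul_sub]
    abel
  neg_mem' := by
    rintro ⟨x, a⟩ ⟨y, hy⟩
    refine ⟨-y + mixed p (p ^ l) a (-a), ?_⟩
    have h := ι_add_pow p l a (-a)
    rw [add_neg_cancel, map_zero, zero_pow (pow_ne_zero _ hp.out.ne_zero)] at h
    simp only at hy
    simp only [Prod.neg_mk, Submodule.coe_neg, Submodule.coe_add, hy, smul_add, smul_neg]
    rw [eq_comm, ← sub_eq_zero, h]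
    abel

theorem EdGroup_map_mem (p l : ℕ) [Fact p.Prime] (f : A →+ B) (z : symPow (p ^ l) A × A)
    (hz : z ∈ EdGroup p l A) :
    ((symPowMap (p ^ l) f).prodMap f) z ∈ EdGroup p l B := by
  obtain ⟨y, hy⟩ := hz
  refine ⟨symPowMap (p ^ l) f y, ?_⟩
  simp [hy, symMap_ι]

/-- The homomorphism `E_d(A) → E_d(B)` induced by `f : A → B`, `(x, a) ↦ (S^d(f) x, f a)`. -/
noncomputable def EdMap (p l : ℕ) [Fact p.Prime] (f : A →+ B) : EdGroup p l A →+ EdGroup p l B :=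
  (((symPowMap (p ^ l) f).prodMap f).comp (EdGroup p l A).subtype).codRestrict (EdGroup p l B)
    (fun z => EdGroup_map_mem p l f z.1 z.2)

/-- The inclusion `S^d(A) → E_d(A)`, `x ↦ (p x, 0)`. -/
noncomputable def EdIncl (p l : ℕ) [hp : Fact p.Prime] (A : Type) [AddCommGroup A] :
    symPow (p ^ l) A →+ EdGroup p l A :=
  ((AddMonoidHom.inl (symPow (p ^ l) A) A).comp (nsmulAddMonoidHom p)).codRestrict (EdGroup p l A)
    (fun x => ⟨x, by simp [hp.out.ne_zero]⟩)

/-- The projection `E_d(A) → A`, `(x, a) ↦ a`. -/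
noncomputable def EdProj (p l : ℕ) [Fact p.Prime] (A : Type) [AddCommGroup A] :
    EdGroup p l A →+ A :=
  (AddMonoidHom.snd (symPow (p ^ l) A) A).comp (EdGroup p l A).subtype

end Ed

/-- The functor `E_d : ab ⥤ Ab` for `d = p ^ l`. -/
noncomputable def E (p l : ℕ) [Fact p.Prime] : FAb where
  obj V := AddCommGrpCat.of (EdGroup p l V.obj)
  map f := AddCommGrpCat.ofHom (EdMap p l f.hom.hom)
  map_id V := by
    refine AddCommGrpCat.hom_ext (AddMonoidHom.ext fun z => Subtype.ext ?_)
    exact Prod.ext (Subtype.ext (DFunLike.congr_fun symMap_id (z.1.1 : SymmetricAlgebra ℤ V.obj)))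
      rfl
  map_comp {X _ _} f g := by
    refine AddCommGrpCat.hom_ext (AddMonoidHom.ext fun z => Subtype.ext ?_)
    exact Prod.ext (Subtype.ext
      (DFunLike.congr_fun (symMap_comp g.hom.hom f.hom.hom) (z.1.1 : SymmetricAlgebra ℤ X.obj))) rfl

/-- The sequence `S^d → E_d → I` in `F(ab; ℤ)` for `d = p ^ l`. -/
noncomputable def extensionSeq (p l : ℕ) [Fact p.Prime] : ShortComplex FAb where
  X₁ := S (p ^ l)
  X₂ := E p l
  X₃ := I
  f :=
    { app V := AddCommGrpCat.ofHom (EdIncl p l V.obj)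
      naturality V W f := by
        ext x
        apply Subtype.ext
        refine Prod.ext (map_nsmul (symPowMap (p ^ l) f.hom.hom) p x).symm ?_
        exact (map_zero f.hom.hom).symm }
  g :=
    { app V := AddCommGrpCat.ofHom (EdProj p l V.obj)
      naturality V W f := rfl }
  zero := by
    ext V x
    rfl

/-- The sequence `S^d ∘ 𝔞 → E_d ∘ 𝔞 → 𝔞` in `F(gr; ℤ)` for `d = p ^ l`. -/
noncomputable abbrev extensionSeqGr (p l : ℕ) [Fact p.Prime] : ShortComplex FGr :=
  (extensionSeq p l).map precompAbelianization

/-! ### Description of `E_d` by generating morphisms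

The morphisms of `ab` between the groups `ℤⁿ` are generated by the structure morphisms of the
bicommutative Hopf algebra object `ℤ`, stabilised by identities on both sides. Below is the functor
on the free category on these generators which is `S^d ⊕ I` on objects and is given by the matrix
with rows `(S^d(g), D_d(g))` and `(0, I(g))` on a generator `g`; `EdIso` identifies it with the
restriction of `E`, compatibly with the inclusion of `S^d` and the projection to `I`. -/

section Presentation

/-- The symmetry `τ`, multiplication `∇`, comultiplication `Δ`, counit `ε`, unit `η`,
antipode. -/
inductive Gen : Type
  | tau | nabla | Delta | eps | eta | antipode

/-- The rank of the source of a generator. -/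
def Gen.src : Gen → ℕ
  | tau => 2
  | nabla => 2
  | Delta => 1
  | eps => 1
  | eta => 0
  | antipode => 1

/-- The rank of the target of a generator. -/
def Gen.tgt : Gen → ℕ
  | tau => 2
  | nabla => 1
  | Delta => 2
  | eps => 0
  | eta => 1
  | antipode => 1

/-- The homomorphism `ℤ^src → ℤ^tgt` of a generator. -/
def Gen.hom : (g : Gen) → (Fin g.src → ℤ) →+ (Fin g.tgt → ℤ)
  | tau => AddMonoidHom.mk' (fun v : Fin 2 → ℤ => (![v 1, v 0] : Fin 2 → ℤ)) (by
      intro v w; ext i; fin_cases i <;> rfl)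
  | nabla => AddMonoidHom.mk' (fun v : Fin 2 → ℤ => (![v 0 + v 1] : Fin 1 → ℤ)) (by
      intro v w; ext i; fin_cases i; exact add_add_add_comm _ _ _ _)
  | Delta => AddMonoidHom.mk' (fun v : Fin 1 → ℤ => (![v 0, v 0] : Fin 2 → ℤ)) (by
      intro v w; ext i; fin_cases i <;> rfl)
  | eps => 0
  | eta => 0
  | antipode => -AddMonoidHom.id _

/-- The block sum `id_n ⊕ f ⊕ id_m`. -/
def blockSum (n m : ℕ) {s t : ℕ} (f : (Fin s → ℤ) →+ (Fin t → ℤ)) :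
    (Fin (n + s + m) → ℤ) →+ (Fin (n + t + m) → ℤ) :=
  AddMonoidHom.mk'
    (fun v => Fin.append
      (Fin.append (fun i => v (Fin.castAdd m (Fin.castAdd s i)))
        (f fun i => v (Fin.castAdd m (Fin.natAdd n i))))
      (fun i => v (Fin.natAdd (n + s) i)))
    (by
      intro v w
      have h : (f fun i => (v + w) (Fin.castAdd m (Fin.natAdd n i))) =
          (f fun i => v (Fin.castAdd m (Fin.natAdd n i))) +
            f fun i => w (Fin.castAdd m (Fin.natAdd n i)) := by
        rw [← map_add]; rfl
      ext i
      refine Fin.addCases (fun i => ?_) (fun i => ?_) i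
      · refine Fin.addCases (fun i => ?_) (fun i => ?_) i
        · simp
        · simpa using congrFun h i
      · simp)

/-- The edges `id_n ⊕ f ⊕ id_m` of the graph `Γ` with vertex set `ℕ`. -/
inductive Edge : ℕ → ℕ → Type
  | mk (n : ℕ) (f : Gen) (m : ℕ) : Edge (n + f.src + m) (n + f.tgt + m)

/-- The homomorphism of an edge. -/
def Edge.hom {a b : ℕ} : Edge a b → ((Fin a → ℤ) →+ (Fin b → ℤ))
  | mk n f m => blockSum n m f.hom

/-- The basis vector `e_i` of `ℤⁿ`. -/
def stdVec {n : ℕ} (i : Fin n) : Fin n → ℤ := Pi.single i 1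

/-- The homomorphism `D_d(g) : ℤ^a → S^d(ℤ^b)` of an edge `g : a → b`. For the comultiplication
(resp. the antipode) in position `n + 1` it sends `e_{n + 1}` to
`∑_{0 < k < d} (1 / p) (d choose k) e_{n + 1} ^ k e_{n + 2} ^ (d - k)`
(resp. `((1 + (-1) ^ d) / p) e_{n + 1} ^ d`) and the other basis vectors to zero;
for the other edges it is zero. -/
noncomputable def Edge.D (p d : ℕ) {a b : ℕ} : Edge a b → ((Fin a → ℤ) →+ symPow d (Fin b → ℤ))
  | mk n .Delta m =>
      (zmultiplesHom (symPow d (Fin (n + 2 + m) → ℤ))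
        (mixed p d (stdVec (Fin.castAdd m (Fin.natAdd n 0)))
          (stdVec (Fin.castAdd m (Fin.natAdd n 1))))).comp
        (Pi.evalAddMonoidHom (fun _ : Fin (n + 1 + m) => ℤ) (Fin.castAdd m (Fin.natAdd n 0)))
  | mk n .antipode m =>
      (zmultiplesHom (symPow d (Fin (n + 1 + m) → ℤ))
        (((1 + (-1) ^ d) / (p : ℤ)) •
          ⟨_, ι_pow_mem d (stdVec (Fin.castAdd m (Fin.natAdd n 0)))⟩)).comp
        (Pi.evalAddMonoidHom (fun _ : Fin (n + 1 + m) => ℤ) (Fin.castAdd m (Fin.natAdd n 0)))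
  | mk _ .tau _ => 0
  | mk _ .nabla _ => 0
  | mk _ .eps _ => 0
  | mk _ .eta _ => 0

/-- The matrix with rows `(S^d(g), D_d(g))` and `(0, I(g))`. -/
noncomputable def Edge.matrix (p d : ℕ) {a b : ℕ} (g : Edge a b) :
    symPow d (Fin a → ℤ) × (Fin a → ℤ) →+ symPow d (Fin b → ℤ) × (Fin b → ℤ) :=
  ((symPowMap d g.hom).coprod (g.D p d)).prod (g.hom.comp (AddMonoidHom.snd _ _))

/-- The vertices of `Γ`. -/
structure Vert : Type where
  rank : ℕ

instance : Quiver Vert := ⟨fun a b => Edge a.rank b.rank⟩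

/-- The functor from the free category on `Γ` to `ab`. -/
def realization : Paths Vert ⥤ Ab :=
  Paths.lift
    { obj := fun a => ⟨AddCommGrpCat.of (Fin a.rank → ℤ),
        inferInstanceAs (Module.Free ℤ (Fin a.rank → ℤ)),
        inferInstanceAs (Module.Finite ℤ (Fin a.rank → ℤ))⟩
      map := fun g => ObjectProperty.homMk (AddCommGrpCat.ofHom (Edge.hom g)) }

/-- The functor on the free category on `Γ` given by `S^d ⊕ I` on vertices and by the matrices
on edges. -/
noncomputable def EPrime (p d : ℕ) : Paths Vert ⥤ AddCommGrpCat.{0} :=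
  Paths.lift
    { obj := fun a => AddCommGrpCat.of (symPow d (Fin a.rank → ℤ) × (Fin a.rank → ℤ))
      map := fun g => AddCommGrpCat.ofHom (Edge.matrix p d g) }

theorem Edge.D_left (p d n m : ℕ) (f : Gen) (i : Fin n) :
    (Edge.mk n f m).D p d (stdVec (Fin.castAdd m (Fin.castAdd f.src i))) = 0 := by
  cases f
  case Delta =>
    have h : (stdVec (Fin.castAdd m (Fin.castAdd 1 i)) : Fin (n + 1 + m) → ℤ)
        (Fin.castAdd m (Fin.natAdd n 0)) = 0 := by
      simp [stdVec, Pi.single_apply, Fin.ext_iff]; omega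
    exact (congrArg (zmultiplesHom _ _) h).trans (map_zero _)
  case antipode =>
    have h : (stdVec (Fin.castAdd m (Fin.castAdd 1 i)) : Fin (n + 1 + m) → ℤ)
        (Fin.castAdd m (Fin.natAdd n 0)) = 0 := by
      simp [stdVec, Pi.single_apply, Fin.ext_iff]; omega
    exact (congrArg (zmultiplesHom _ _) h).trans (map_zero _)
  all_goals rfl

theorem Edge.D_right (p d n m : ℕ) (f : Gen) (i : Fin m) :
    (Edge.mk n f m).D p d (stdVec (Fin.natAdd (n + f.src) i)) = 0 := by
  cases f
  case Delta =>
    have h : (stdVec (Fin.natAdd (n + 1) i) : Fin (n + 1 + m) → ℤ)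
        (Fin.castAdd m (Fin.natAdd n 0)) = 0 := by
      simp [stdVec, Pi.single_apply, Fin.ext_iff]; omega
    exact (congrArg (zmultiplesHom _ _) h).trans (map_zero _)
  case antipode =>
    have h : (stdVec (Fin.natAdd (n + 1) i) : Fin (n + 1 + m) → ℤ)
        (Fin.castAdd m (Fin.natAdd n 0)) = 0 := by
      simp [stdVec, Pi.single_apply, Fin.ext_iff]; omega
    exact (congrArg (zmultiplesHom _ _) h).trans (map_zero _)
  all_goals rfl

theorem Edge.D_Delta (p d n m : ℕ) :
    (Edge.mk n .Delta m).D p d (stdVec (Fin.castAdd m (Fin.natAdd n (0 : Fin 1)))) =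
      mixed p d (stdVec (Fin.castAdd m (Fin.natAdd n (0 : Fin 2))))
          (stdVec (Fin.castAdd m (Fin.natAdd n (1 : Fin 2)))) := by
  have h : (stdVec (Fin.castAdd m (Fin.natAdd n (0 : Fin 1))) : Fin (n + 1 + m) → ℤ)
      (Fin.castAdd m (Fin.natAdd n 0)) = 1 := Pi.single_eq_same _ _
  exact (congrArg (zmultiplesHom _ _) h).trans (one_zsmul _)

theorem Edge.D_antipode (p d n m : ℕ) :
    (Edge.mk n .antipode m).D p d (stdVec (Fin.castAdd m (Fin.natAdd n (0 : Fin 1)))) =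
      ((1 + (-1) ^ d) / (p : ℤ)) •
        ⟨_, ι_pow_mem d (stdVec (Fin.castAdd m (Fin.natAdd n (0 : Fin 1))))⟩ := by
  have h : (stdVec (Fin.castAdd m (Fin.natAdd n (0 : Fin 1))) : Fin (n + 1 + m) → ℤ)
      (Fin.castAdd m (Fin.natAdd n 0)) = 1 := Pi.single_eq_same _ _
  exact (congrArg (zmultiplesHom _ _) h).trans (one_zsmul _)

variable (p l : ℕ) [hp : Fact p.Prime]

theorem stdVec_mem_Ed {n : ℕ} (i : Fin n) :
    ((⟨_, ι_pow_mem (p ^ l) (stdVec i)⟩, stdVec i) :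
      symPow (p ^ l) (Fin n → ℤ) × (Fin n → ℤ)) ∈ EdGroup p l (Fin n → ℤ) :=
  ⟨0, by simp⟩

/-- The homomorphism `ℤⁿ → E_d(ℤⁿ)`, `e_i ↦ (e_i ^ d, e_i)`. -/
noncomputable def EdBasis (n : ℕ) : (Fin n → ℤ) →+ EdGroup p l (Fin n → ℤ) :=
  AddMonoidHom.mk' (fun v => ∑ i, v i • ⟨_, stdVec_mem_Ed p l i⟩) (by
    intro v w; simp [add_smul, Finset.sum_add_distrib])

theorem EdProj_EdBasis (n : ℕ) (v : Fin n → ℤ) : EdProj p l _ (EdBasis p l n v) = v := by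
  have h : ∀ i : Fin n, EdProj p l _ ⟨_, stdVec_mem_Ed p l i⟩ = stdVec i := fun _ => rfl
  simp only [EdBasis, AddMonoidHom.mk'_apply, map_sum, map_zsmul, h]
  ext j
  simp [stdVec, Pi.single_apply]

theorem EdBasis_stdVec (n : ℕ) (i : Fin n) :
    EdBasis p l n (stdVec i) = ⟨_, stdVec_mem_Ed p l i⟩ := by
  simp only [EdBasis, AddMonoidHom.mk'_apply]
  rw [Finset.sum_eq_single i] <;> simp +contextual [stdVec]

/-- The identification of `S^d(ℤⁿ) ⊕ ℤⁿ` with `E_d(ℤⁿ)`,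
`(x, ∑ vᵢ eᵢ) ↦ (p x + ∑ vᵢ eᵢ ^ d, ∑ vᵢ eᵢ)`. -/
noncomputable def EdCoord (n : ℕ) :
    symPow (p ^ l) (Fin n → ℤ) × (Fin n → ℤ) ≃+ EdGroup p l (Fin n → ℤ) :=
  AddEquiv.ofBijective ((EdIncl p l _).coprod (EdBasis p l n)) (by
    constructor
    · rw [injective_iff_map_eq_zero]
      rintro ⟨x, v⟩ h
      have hv : v = 0 := by
        have := congrArg (EdProj p l _) h
        rw [AddMonoidHom.coprod_apply, map_add, EdProj_EdBasis, map_zero] at this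
        exact (zero_add v).symm.trans this
      subst hv
      have h1 := congrArg (fun z => (z.1.1 : SymmetricAlgebra ℤ (Fin n → ℤ))) h
      have h2 : p • (x : SymmetricAlgebra ℤ (Fin n → ℤ)) = 0 := by
        refine Eq.trans ?_ h1
        rw [AddMonoidHom.coprod_apply, map_zero, add_zero]
        rfl
      have h3 : (x : SymmetricAlgebra ℤ (Fin n → ℤ)) = 0 := by
        rw [← natCast_zsmul] at h2
        exact (smul_eq_zero.mp h2).resolve_left (by exact_mod_cast hp.out.ne_zero)
      exact Prod.ext (Subtype.ext h3) rfl
    · intro z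
      have hz : (z - EdBasis p l n z.1.2).1 ∈ EdGroup p l (Fin n → ℤ) := Subtype.property _
      obtain ⟨y, hy⟩ := hz
      have h0 : (z - EdBasis p l n z.1.2).1.2 = 0 := by
        have := EdProj_EdBasis p l n z.1.2
        change z.1.2 - EdProj p l _ (EdBasis p l n z.1.2) = 0
        rw [this, sub_self]
      refine ⟨(y, z.1.2), ?_⟩
      rw [AddMonoidHom.coprod_apply, ← eq_sub_iff_add_eq]
      apply Subtype.ext
      refine Prod.ext (Subtype.ext ?_) h0.symm
      rw [hy, h0]
      rw [map_zero, zero_pow (pow_ne_zero _ hp.out.ne_zero), zero_add]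
      rfl)

theorem EdCoord_apply (n : ℕ) (x : symPow (p ^ l) (Fin n → ℤ)) (v : Fin n → ℤ) :
    EdCoord p l n (x, v) = EdIncl p l _ x + EdBasis p l n v := rfl

/-- The element `(a ^ d, a)` of `E_d(A)`. -/
noncomputable def EdDiag {A : Type} [AddCommGroup A] (a : A) : EdGroup p l A :=
  ⟨(⟨_, ι_pow_mem (p ^ l) a⟩, a), 0, by simp⟩

theorem EdDiag_zero {A : Type} [AddCommGroup A] : EdDiag p l (0 : A) = 0 := by
  apply Subtype.ext
  refine Prod.ext (Subtype.ext ?_) rfl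
  simp [EdDiag, hp.out.ne_zero]

theorem EdDiag_add {A : Type} [AddCommGroup A] (a b : A) :
    EdDiag p l (a + b) = EdIncl p l A (mixed p (p ^ l) a b) + (EdDiag p l a + EdDiag p l b) := by
  apply Subtype.ext
  refine Prod.ext (Subtype.ext ?_) (zero_add _).symm
  exact (ι_add_pow p l a b).trans (add_comm _ _)

theorem sign_div_mul : (p : ℤ) * ((1 + (-1) ^ p ^ l) / (p : ℤ)) = 1 + (-1) ^ p ^ l := by
  apply Int.mul_ediv_cancel'
  rcases hp.out.eq_two_or_odd' with rfl | h
  · rcases Nat.even_or_odd (2 ^ l) with h | h <;> simp [h.neg_one_pow]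
  · simp [(h.pow : Odd (p ^ l)).neg_one_pow]

theorem EdDiag_neg {A : Type} [AddCommGroup A] (a : A) :
    EdDiag p l (-a) =
      EdIncl p l A (((1 + (-1) ^ p ^ l) / (p : ℤ)) • ⟨_, ι_pow_mem (p ^ l) a⟩) +
        -EdDiag p l a := by
  apply Subtype.ext
  refine Prod.ext (Subtype.ext ?_) (zero_add _).symm
  change SymmetricAlgebra.ι ℤ A (-a) ^ p ^ l =
    p • (((1 + (-1) ^ p ^ l) / (p : ℤ)) • SymmetricAlgebra.ι ℤ A a ^ p ^ l) +
      -(SymmetricAlgebra.ι ℤ A a ^ p ^ l)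
  rw [← natCast_zsmul, smul_smul, sign_div_mul, map_neg, neg_pow, add_smul, one_smul,
    zsmul_eq_mul]
  push_cast
  abel

theorem EdMap_EdDiag {A B : Type} [AddCommGroup A] [AddCommGroup B] (f : A →+ B) (a : A) :
    EdMap p l f (EdDiag p l a) = EdDiag p l (f a) := by
  apply Subtype.ext
  refine Prod.ext (Subtype.ext ?_) rfl
  exact (map_pow _ _ _).trans (congrArg (· ^ p ^ l) (symMap_ι f a))

theorem EdMap_EdIncl {A B : Type} [AddCommGroup A] [AddCommGroup B] (f : A →+ B)
    (x : symPow (p ^ l) A) :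
    EdMap p l f (EdIncl p l A x) = EdIncl p l B (symPowMap (p ^ l) f x) := by
  apply Subtype.ext
  exact Prod.ext (map_nsmul (symPowMap (p ^ l) f) p x) (map_zero f)

/-- The inclusion of `ℤ^t` as the middle block of `ℤ^(n + t + m)`. -/
def middle (n m : ℕ) {t : ℕ} (w : Fin t → ℤ) : Fin (n + t + m) → ℤ :=
  Fin.append (Fin.append 0 w) 0

theorem middle_stdVec (n m : ℕ) {t : ℕ} (i : Fin t) :
    middle n m (stdVec i) = stdVec (Fin.castAdd m (Fin.natAdd n i)) := by
  ext j
  refine Fin.addCases (fun j => ?_) (fun j => ?_) j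
  · refine Fin.addCases (fun j => ?_) (fun j => ?_) j
    · simp [middle, stdVec, Pi.single_apply, Fin.ext_iff]; omega
    · simp [middle, stdVec, Pi.single_apply, Fin.ext_iff]
  · simp [middle, stdVec, Pi.single_apply, Fin.ext_iff]; omega

theorem middle_add (n m : ℕ) {t : ℕ} (v w : Fin t → ℤ) :
    middle n m (v + w) = middle n m v + middle n m w := by
  ext j
  refine Fin.addCases (fun j => ?_) (fun j => ?_) j
  · refine Fin.addCases (fun j => ?_) (fun j => ?_) j <;> simp [middle]
  · simp [middle]

theorem middle_neg (n m : ℕ) {t : ℕ} (v : Fin t → ℤ) :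
    middle n m (-v) = -middle n m v := by
  ext j
  refine Fin.addCases (fun j => ?_) (fun j => ?_) j
  · refine Fin.addCases (fun j => ?_) (fun j => ?_) j <;> simp [middle]
  · simp [middle]

theorem middle_zero (n m : ℕ) {t : ℕ} : middle n m (0 : Fin t → ℤ) = 0 := by
  have h := middle_add n m (0 : Fin t → ℤ) 0
  rw [add_zero] at h
  exact left_eq_add.mp h

theorem blockSum_left (n m : ℕ) {s t : ℕ} (f : (Fin s → ℤ) →+ (Fin t → ℤ)) (i : Fin n) :
    blockSum n m f (stdVec (Fin.castAdd m (Fin.castAdd s i))) =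
      stdVec (Fin.castAdd m (Fin.castAdd t i)) := by
  have h : (fun j : Fin s => (stdVec (Fin.castAdd m (Fin.castAdd s i)) : Fin (n + s + m) → ℤ)
      (Fin.castAdd m (Fin.natAdd n j))) = 0 := by
    ext j
    simp [stdVec, Pi.single_apply, Fin.ext_iff]; omega
  ext j
  simp only [blockSum, AddMonoidHom.mk'_apply, h, map_zero]
  refine Fin.addCases (fun j => ?_) (fun j => ?_) j
  · refine Fin.addCases (fun j => ?_) (fun j => ?_) j
    · simp [stdVec, Pi.single_apply, Fin.ext_iff]
    · simp [stdVec, Pi.single_apply, Fin.ext_iff]; omega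
  · simp [stdVec, Pi.single_apply, Fin.ext_iff]; omega

theorem blockSum_middle (n m : ℕ) {s t : ℕ} (f : (Fin s → ℤ) →+ (Fin t → ℤ)) (i : Fin s) :
    blockSum n m f (stdVec (Fin.castAdd m (Fin.natAdd n i))) = middle n m (f (stdVec i)) := by
  have h : (fun j : Fin s => (stdVec (Fin.castAdd m (Fin.natAdd n i)) : Fin (n + s + m) → ℤ)
      (Fin.castAdd m (Fin.natAdd n j))) = stdVec i := by
    ext j
    simp [stdVec, Pi.single_apply, Fin.ext_iff]
  ext j
  simp only [blockSum, AddMonoidHom.mk'_apply, h]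
  refine Fin.addCases (fun j => ?_) (fun j => ?_) j
  · refine Fin.addCases (fun j => ?_) (fun j => ?_) j
    · simp [middle, stdVec, Pi.single_apply, Fin.ext_iff]; omega
    · simp [middle]
  · simp [middle, stdVec, Pi.single_apply, Fin.ext_iff]; omega

theorem blockSum_right (n m : ℕ) {s t : ℕ} (f : (Fin s → ℤ) →+ (Fin t → ℤ)) (i : Fin m) :
    blockSum n m f (stdVec (Fin.natAdd (n + s) i)) = stdVec (Fin.natAdd (n + t) i) := by
  have h : (fun j : Fin s => (stdVec (Fin.natAdd (n + s) i) : Fin (n + s + m) → ℤ)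
      (Fin.castAdd m (Fin.natAdd n j))) = 0 := by
    ext j
    simp [stdVec, Pi.single_apply, Fin.ext_iff]; omega
  ext j
  simp only [blockSum, AddMonoidHom.mk'_apply, h, map_zero]
  refine Fin.addCases (fun j => ?_) (fun j => ?_) j
  · refine Fin.addCases (fun j => ?_) (fun j => ?_) j
    · simp [stdVec, Pi.single_apply, Fin.ext_iff]; omega
    · simp [stdVec, Pi.single_apply, Fin.ext_iff]; omega
  · simp [stdVec, Pi.single_apply, Fin.ext_iff]

theorem EdBasis_eq_EdDiag {n : ℕ} (i : Fin n) :
    EdBasis p l n (stdVec i) = EdDiag p l (stdVec i) := EdBasis_stdVec p l n i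

theorem EdDiag_edge_of {a b : ℕ} (g : Edge a b) (i : Fin a) (j : Fin b)
    (h : g.hom (stdVec i) = stdVec j) (hD : g.D p (p ^ l) (stdVec i) = 0) :
    EdDiag p l (g.hom (stdVec i)) =
      EdIncl p l _ (g.D p (p ^ l) (stdVec i)) + EdBasis p l b (g.hom (stdVec i)) := by
  rw [h, hD, map_zero, zero_add, EdBasis_eq_EdDiag]

theorem EdDiag_edge_of_zero {a b : ℕ} (g : Edge a b) (i : Fin a)
    (h : g.hom (stdVec i) = 0) (hD : g.D p (p ^ l) (stdVec i) = 0) :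
    EdDiag p l (g.hom (stdVec i)) =
      EdIncl p l _ (g.D p (p ^ l) (stdVec i)) + EdBasis p l b (g.hom (stdVec i)) := by
  rw [h, hD, map_zero, map_zero, zero_add, EdDiag_zero]

theorem EdDiag_edge {a b : ℕ} (g : Edge a b) (i : Fin a) :
    EdDiag p l (g.hom (stdVec i)) =
      EdIncl p l _ (g.D p (p ^ l) (stdVec i)) + EdBasis p l b (g.hom (stdVec i)) := by
  obtain ⟨n, f, m⟩ := g
  refine Fin.addCases (fun i => ?_) (fun i => ?_) i
  · refine Fin.addCases (fun i => ?_) (fun i => ?_) i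
    · exact EdDiag_edge_of p l _ _ _ (blockSum_left n m f.hom i) (Edge.D_left p _ n m f i)
    · have hm : (Edge.mk n f m).hom (stdVec (Fin.castAdd m (Fin.natAdd n i))) =
          middle n m (f.hom (stdVec i)) := blockSum_middle n m f.hom i
      cases f
      case tau =>
        have key : ∀ i : Fin 2, Gen.tau.hom (stdVec i) = (stdVec (1 - i) : Fin 2 → ℤ) := by
          intro i; ext j; fin_cases i <;> fin_cases j <;> rfl
        exact EdDiag_edge_of p l _ _ (Fin.castAdd m (Fin.natAdd n ((1 : Fin 2) - (show Fin 2 from i))))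
          (hm.trans ((congrArg (middle n m) (key i)).trans (middle_stdVec n m _))) rfl
      case nabla =>
        have key : ∀ i : Fin 2, Gen.nabla.hom (stdVec i) = (stdVec 0 : Fin 1 → ℤ) := by
          intro i; ext j; fin_cases i <;> fin_cases j <;> rfl
        exact EdDiag_edge_of p l _ _ (Fin.castAdd m (Fin.natAdd n (0 : Fin 1)))
          (hm.trans ((congrArg (middle n m) (key i)).trans (middle_stdVec n m _))) rfl
      case Delta =>
        obtain rfl : i = (0 : Fin 1) := Subsingleton.elim (α := Fin 1) _ _
        have key : Gen.Delta.hom (stdVec (0 : Fin 1)) =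
            ((stdVec 0 + stdVec 1 : Fin 2 → ℤ)) := by
          ext j; fin_cases j <;> rfl
        have hm' : (Edge.mk n .Delta m).hom (stdVec (Fin.castAdd m (Fin.natAdd n (0 : Fin 1)))) =
            stdVec (Fin.castAdd m (Fin.natAdd n (0 : Fin 2))) +
              stdVec (Fin.castAdd m (Fin.natAdd n (1 : Fin 2))) := by
          refine hm.trans ((congrArg (middle n m) key).trans ?_)
          exact (middle_add n m _ _).trans
            (congrArg₂ (· + ·) (middle_stdVec n m _) (middle_stdVec n m _))
        have hD := Edge.D_Delta p (p ^ l) n m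
        refine (congrArg (EdDiag p l) hm').trans ?_
        refine Eq.trans ?_ (congrArg₂ (fun x y => EdIncl p l _ x + EdBasis p l _ y) hD.symm
          hm'.symm)
        refine (EdDiag_add p l _ _).trans (congrArg _ ?_)
        exact (congrArg₂ (· + ·) (EdBasis_eq_EdDiag p l _).symm
          (EdBasis_eq_EdDiag p l _).symm).trans (map_add _ _ _).symm
      case eps =>
        exact EdDiag_edge_of_zero p l _ _ (hm.trans (middle_zero n m)) rfl
      case eta => exact Fin.elim0 i
      case antipode =>
        obtain rfl : i = (0 : Fin 1) := Subsingleton.elim (α := Fin 1) _ _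
        have hm' : (Edge.mk n .antipode m).hom
            (stdVec (Fin.castAdd m (Fin.natAdd n (0 : Fin 1)))) =
            -stdVec (Fin.castAdd m (Fin.natAdd n (0 : Fin 1))) := by
          refine hm.trans ?_
          refine (middle_neg n m (stdVec (0 : Fin 1))).trans ?_
          exact congrArg (- ·) (middle_stdVec n m _)
        have hD := Edge.D_antipode p (p ^ l) n m
        refine (congrArg (EdDiag p l) hm').trans ?_
        refine Eq.trans ?_ (congrArg₂ (fun x y => EdIncl p l _ x + EdBasis p l _ y) hD.symm
          hm'.symm)
        refine (EdDiag_neg p l _).trans (congrArg _ ?_)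
        exact (congrArg (- ·) (EdBasis_eq_EdDiag p l _).symm).trans (map_neg _ _).symm
  · exact EdDiag_edge_of p l _ _ _ (blockSum_right n m f.hom i) (Edge.D_right p _ n m f i)

/-- The coordinates `EdCoord` carry the matrix of an edge to the homomorphism of `E_d` that the
edge induces. -/
theorem EdCoord_edge {a b : ℕ} (g : Edge a b) (z : symPow (p ^ l) (Fin a → ℤ) × (Fin a → ℤ)) :
    EdCoord p l b (g.matrix p (p ^ l) z) = EdMap p l g.hom (EdCoord p l a z) := by
  have h : (EdBasis p l b).comp g.hom + (EdIncl p l _).comp (g.D p (p ^ l)) =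
      (EdMap p l g.hom).comp (EdBasis p l a) := by
    refine AddMonoidHom.functions_ext' _ _ _ fun i => AddMonoidHom.ext_int ?_
    have := EdDiag_edge p l g i
    rw [← EdMap_EdDiag, ← EdBasis_eq_EdDiag] at this
    exact (add_comm _ _).trans this.symm
  obtain ⟨x, v⟩ := z
  have hv := DFunLike.congr_fun h v
  simp only [AddMonoidHom.add_apply, AddMonoidHom.comp_apply] at hv
  rw [EdCoord_apply p l a, map_add, EdMap_EdIncl, ← hv, add_comm (EdBasis p l b _), ← add_assoc,
    ← map_add]
  rfl

/-- The restriction of `E_d` to the free category on `Γ` is the functor `EPrime`. -/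
noncomputable def EdIso : EPrime p (p ^ l) ≅ realization ⋙ E p l :=
  Paths.liftNatIso (fun a => (EdCoord p l a.rank).toAddCommGrpIso) (fun {a b} g => by
    ext z
    exact EdCoord_edge p l g z)

theorem EdIso_inl (a : Vert) (x : symPow (p ^ l) (Fin a.rank → ℤ)) :
    ((EdIso p l).hom.app a).hom (x, 0) =
      ((extensionSeq p l).f.app (realization.obj a)).hom x := by
  change EdIncl p l _ x + EdBasis p l _ 0 = EdIncl p l _ x
  rw [map_zero, add_zero]

theorem EdIso_snd (a : Vert) (z : symPow (p ^ l) (Fin a.rank → ℤ) × (Fin a.rank → ℤ)) :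
    ((extensionSeq p l).g.app (realization.obj a)).hom (((EdIso p l).hom.app a).hom z) =
      z.2 := by
  change EdProj p l _ (EdIncl p l _ z.1 + EdBasis p l _ z.2) = z.2
  rw [map_add, EdProj_EdBasis]
  exact zero_add _

end Presentation

end FunctorExt

open FunctorExt

/-!
The functor `G ↦ ℤ[G]` on `gr` is projective, being represented by the free group on one generator,
and the kernel `K` of `ℤ[G] → G / [G, G]` is generated by the elements `[gh] - [g] - [h]`
(`closure_cross`). Hence every class in `Ext¹(𝔞, F)` comes from a natural map `φ : K → F`, which is
determined by its value on `[xy] - [x] - [y]`, where `x`, `y` are the generators of the free group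
on two generators. The associativity of multiplication in the free group on three generators makes
this value a two-cocycle (`cross_cocycle`).

For `F = S^d ∘ 𝔞` the value is a binary form `f` of degree `d` with
`f(x + y, z) + f(x, y) = f(x, y + z) + f(y, z)`. The part of this identity that is linear in `x`
gives `d f = c ((x + y) ^ d - x ^ d - y ^ d)` for an integer `c` (`coeff_of_cocycle`), and
`(x + y) ^ d - x ^ d - y ^ d` is the coboundary of `x ^ d`. So `d` kills `Ext¹(𝔞, S^d ∘ 𝔞)`
(`zsmul_ext_eq_zero`).

Precomposition with abelianization is exact, and it is fully faithful because abelianization is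
full and essentially surjective. Such a functor is injective on `Ext¹`
(`mapExtAddHom_one_injective`), and it reaches each torsion class, which is the Bockstein of a
morphism `𝔞 → (S^d / d) ∘ 𝔞`, hence of a morphism `I → S^d / d` (`exists_mapExtAddHom_one_eq`).

If `d = p ^ l` with `l > 0`, then `(d choose p ^ (l - 1))` has `p`-adic valuation one, so `f` is a
multiple of the form `((x + y) ^ d - x ^ d - y ^ d) / p`, which is the cocycle of the extension
`E_d` (`exists_mixed_cocycle`). Thus the class of `E_d` generates the group and is killed by `p`. It
is nonzero as there is no section that is natural for multiplication by `2` on `ℤ`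
(`extensionClass_ne_zero`).
-/

namespace FunctorExt

open Limits

/-! ### Representable projectives and first extension groups -/

section Generic

universe u v

variable {C : Type u} [Category.{v} C]

/-- The functor `Y ↦ ℤ[Hom(X, Y)]`, which represents evaluation at `X`. -/
abbrev freeYoneda (X : C) : C ⥤ AddCommGrpCat.{v} :=
  coyoneda.obj (Opposite.op X) ⋙ AddCommGrpCat.free

/-- The basis element `[h]` of `ℤ[Hom(X, Y)]`. -/
abbrev freeYoneda.of {X Y : C} (h : X ⟶ Y) : (freeYoneda X).obj Y :=
  FreeAbelianGroup.of h

theorem freeYoneda.map_of {X Y Z : C} (h : X ⟶ Y) (g : Y ⟶ Z) :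
    ((freeYoneda X).map g).hom (of h) = of (h ≫ g) :=
  FreeAbelianGroup.map_of_apply h

/-- The natural transformation `ℤ[Hom(X, -)] ⟶ F` that sends `[𝟙 X]` to `t`. -/
def freeYoneda.desc {X : C} {F : C ⥤ AddCommGrpCat.{v}} (t : F.obj X) : freeYoneda X ⟶ F where
  app Y := AddCommGrpCat.ofHom (FreeAbelianGroup.lift fun h : X ⟶ Y => (F.map h).hom t)
  naturality Y Z g := by
    refine AddCommGrpCat.hom_ext (FreeAbelianGroup.lift_ext _ _ fun h => ?_)
    change FreeAbelianGroup.lift _ (FreeAbelianGroup.map _ (FreeAbelianGroup.of _)) =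
      (F.map g).hom (FreeAbelianGroup.lift _ (FreeAbelianGroup.of _))
    rw [FreeAbelianGroup.map_of_apply, FreeAbelianGroup.lift_apply_of,
      FreeAbelianGroup.lift_apply_of]
    exact ConcreteCategory.congr_hom (F.map_comp h g) t

theorem freeYoneda.desc_of {X Y : C} {F : C ⥤ AddCommGrpCat.{v}} (t : F.obj X) (h : X ⟶ Y) :
    ((desc t).app Y).hom (of h) = (F.map h).hom t :=
  FreeAbelianGroup.lift_apply_of _ _

theorem freeYoneda.hom_ext {X : C} {F : C ⥤ AddCommGrpCat.{v}} {φ ψ : freeYoneda X ⟶ F}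
    (H : (φ.app X).hom (of (𝟙 X)) = (ψ.app X).hom (of (𝟙 X))) : φ = ψ := by
  have key : ∀ (χ : freeYoneda X ⟶ F) (Y : C) (h : X ⟶ Y),
      (χ.app Y).hom (of h) = (F.map h).hom ((χ.app X).hom (of (𝟙 X))) := by
    intro χ Y h
    have := ConcreteCategory.congr_hom (χ.naturality h) (of (𝟙 X))
    refine Eq.trans ?_ this
    change _ = (χ.app Y).hom (((freeYoneda X).map h).hom (of (𝟙 X)))
    rw [map_of, Category.id_comp]
  ext Y : 2
  refine AddCommGrpCat.hom_ext (FreeAbelianGroup.lift_ext _ _ fun h => ?_)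
  exact (key φ Y h).trans ((congrArg _ H).trans (key ψ Y h).symm)

instance freeYoneda.projective (X : C) : Projective (freeYoneda X) where
  factors {E F} f e he := by
    have h1 : Epi (e.app X) := inferInstance
    obtain ⟨t, ht⟩ := (AddCommGrpCat.epi_iff_surjective _).mp h1 ((f.app X).hom (of (𝟙 X)))
    refine ⟨desc t, hom_ext ?_⟩
    change (e.app X).hom (((desc t).app X).hom (of (𝟙 X))) = _
    rw [desc_of, E.map_id]
    exact ht

/-- A complex of functors to abelian groups is exact when its values are. -/
theorem exact_of_exact_evaluation {S : ShortComplex (C ⥤ AddCommGrpCat.{v})}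
    (h : ∀ X, (S.map ((evaluation _ _).obj X)).Exact) : S.Exact := by
  rw [ShortComplex.exact_iff_isZero_homology]
  refine (Functor.isZero_iff _).mpr fun X => ?_
  exact ((ShortComplex.exact_iff_isZero_homology _).mp (h X)).of_iso
    (S.mapHomologyIso ((evaluation _ _).obj X)).symm

end Generic

section Ext

variable {C : Type*} [Category* C] [Abelian C] [HasExt C] {T : ShortComplex C}

/-- If the middle term is projective, every class in `Ext¹` is a pushout of the extension. -/
theorem exists_eq_extClass_comp_mk₀ (hT : T.ShortExact) [Projective T.X₂] {Y : C}
    (α : Ext T.X₃ Y 1) : ∃ φ : T.X₁ ⟶ Y, α = hT.extClass.comp (Ext.mk₀ φ) (add_zero 1) := by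
  obtain ⟨x, hx⟩ := Ext.contravariant_sequence_exact₃ hT Y α
    (Ext.eq_zero_of_projective _) (add_zero 1)
  obtain ⟨φ, rfl⟩ := (Ext.mk₀_bijective _ _).2 x
  exact ⟨φ, hx.symm⟩

theorem extClass_comp_mk₀_eq_zero_iff (hT : T.ShortExact) {Y : C} (φ : T.X₁ ⟶ Y) :
    hT.extClass.comp (Ext.mk₀ φ) (add_zero 1) = 0 ↔ ∃ ψ : T.X₂ ⟶ Y, T.f ≫ ψ = φ := by
  constructor
  · intro h
    obtain ⟨x, hx⟩ := Ext.contravariant_sequence_exact₁ hT Y (Ext.mk₀ φ) (add_zero 1) h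
    obtain ⟨ψ, rfl⟩ := (Ext.mk₀_bijective _ _).2 x
    exact ⟨ψ, (Ext.mk₀_bijective _ _).1 (by simpa using hx)⟩
  · rintro ⟨ψ, rfl⟩
    rw [← Ext.mk₀_comp_mk₀, hT.extClass_comp_assoc]

/-- The class of an extension vanishes only if the extension splits. -/
theorem exists_section_of_extClass_eq_zero (hT : T.ShortExact) (h : hT.extClass = 0) :
    ∃ s : T.X₃ ⟶ T.X₂, s ≫ T.g = 𝟙 _ := by
  obtain ⟨x, hx⟩ := Ext.covariant_sequence_exact₃ T.X₃ hT (Ext.mk₀ (𝟙 T.X₃)) (zero_add 1)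
    (by rw [h, Ext.comp_zero])
  obtain ⟨s, rfl⟩ := (Ext.mk₀_bijective _ _).2 x
  exact ⟨s, (Ext.mk₀_bijective _ _).1 (by simpa using hx)⟩

/-- The map `φ ↦ φ_*(α)` from `Hom(Y, Z)` to `Ext(X, Z)` given by a class `α` in `Ext(X, Y)`. -/
noncomputable def compMk₀ {X Y : C} {n : ℕ} (α : Ext X Y n) (Z : C) : (Y ⟶ Z) →+ Ext X Z n :=
  AddMonoidHom.mk' (fun φ => α.comp (Ext.mk₀ φ) (add_zero n))
    (fun φ ψ => by rw [Ext.mk₀_add, Ext.comp_add])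

theorem compMk₀_apply {X Y Z : C} {n : ℕ} (α : Ext X Y n) (φ : Y ⟶ Z) :
    compMk₀ α Z φ = α.comp (Ext.mk₀ φ) (add_zero n) := rfl

variable {D : Type*} [Category* D] [Abelian D] [HasExt D] (F : C ⥤ D) [F.Additive]
  [PreservesFiniteLimits F] [PreservesFiniteColimits F] [F.Full]

/-- A fully faithful exact functor is injective on `Ext¹(X, -)` as soon as `X` is a quotient of a
projective: an extension of `F.map φ` along the image of the presentation comes from an extension
of `φ`. -/
theorem mapExtAddHom_one_injective [F.Faithful] (hT : T.ShortExact) [Projective T.X₂] (Y : C) :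
    Function.Injective (F.mapExtAddHom T.X₃ Y 1) := by
  rw [injective_iff_map_eq_zero]
  intro β hβ
  obtain ⟨φ, rfl⟩ := exists_eq_extClass_comp_mk₀ hT β
  rw [Functor.mapExtAddHom_apply, Ext.mapExactFunctor_comp, Ext.mapExactFunctor_mk₀,
    Ext.mapExactFunctor_extClass] at hβ
  obtain ⟨ψ, hψ⟩ := (extClass_comp_mk₀_eq_zero_iff (hT.map_of_exact F) (F.map φ)).mp hβ
  obtain ⟨ψ', rfl⟩ := F.map_surjective ψ
  exact (extClass_comp_mk₀_eq_zero_iff hT φ).mpr ⟨ψ', F.map_injective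
    ((F.map_comp T.f ψ').trans hψ)⟩

/-- The image of a fully faithful exact functor on `Ext¹(F X, F Y)` contains every class killed by
an integer `n` that acts injectively on `Y`: such a class is the Bockstein of a morphism from
`F X` to `F (Y / n)`, which comes from a morphism `X ⟶ Y / n`. -/
theorem exists_mapExtAddHom_one_eq {X Y : C} (n : ℤ) [Mono (n • 𝟙 Y)]
    (α : Ext (F.obj X) (F.obj Y) 1) (hα : n • α = 0) :
    ∃ β, F.mapExtAddHom X Y 1 β = α := by
  let T := ShortComplex.mk (n • 𝟙 Y) (cokernel.π (n • 𝟙 Y)) (cokernel.condition _)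
  have hT : T.ShortExact := { exact := ShortComplex.exact_cokernel _ }
  have h0 : α.comp (Ext.mk₀ (F.map (n • 𝟙 Y))) (add_zero 1) = 0 := by
    rw [F.map_zsmul, F.map_id, ← compMk₀_apply, map_zsmul, compMk₀_apply, Ext.comp_mk₀_id, hα]
  obtain ⟨x, hx⟩ := Ext.covariant_sequence_exact₁ _ (hT.map_of_exact F) α h0 (zero_add 1)
  obtain ⟨φ, rfl⟩ := (Ext.mk₀_bijective _ _).2 x
  obtain ⟨φ', rfl⟩ := F.map_surjective (X := X) (Y := T.X₃) φ
  refine ⟨(Ext.mk₀ φ').comp hT.extClass (zero_add 1), ?_⟩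
  rw [Functor.mapExtAddHom_apply, Ext.mapExactFunctor_comp, Ext.mapExactFunctor_mk₀,
    Ext.mapExactFunctor_extClass]
  exact hx

end Ext

/-- Precomposition with a full, essentially surjective functor is full. -/
theorem full_whiskeringLeft_of_full {A B D : Type*} [Category* A] [Category* B] [Category* D]
    (L : A ⥤ B) [L.Full] [L.EssSurj] : ((Functor.whiskeringLeft A B D).obj L).Full where
  map_surjective {G H} φ := by
    refine ⟨{ app := fun Y => G.map (L.objObjPreimageIso Y).inv ≫ φ.app (L.objPreimage Y) ≫
                H.map (L.objObjPreimageIso Y).hom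
              naturality := ?_ }, ?_⟩
    · intro Y Z g
      obtain ⟨k, hk⟩ := L.map_surjective
        ((L.objObjPreimageIso Y).hom ≫ g ≫ (L.objObjPreimageIso Z).inv)
      have h1 : g ≫ (L.objObjPreimageIso Z).inv = (L.objObjPreimageIso Y).inv ≫ L.map k := by
        simp [hk]
      have h2 : L.map k ≫ (L.objObjPreimageIso Z).hom = (L.objObjPreimageIso Y).hom ≫ g := by
        simp [hk]
      have h3 : G.map (L.map k) ≫ φ.app _ = φ.app _ ≫ H.map (L.map k) := φ.naturality k
      rw [← Category.assoc, ← G.map_comp, h1, G.map_comp, Category.assoc, reassoc_of% h3,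
        ← H.map_comp, h2, H.map_comp]
      simp
    · ext X
      obtain ⟨k, hk⟩ := L.map_surjective (L.objObjPreimageIso (L.obj X)).hom
      have h3 : G.map (L.map k) ≫ φ.app _ = φ.app _ ≫ H.map (L.map k) := φ.naturality k
      change G.map _ ≫ φ.app _ ≫ H.map _ = φ.app X
      rw [← hk, ← h3, hk, ← G.map_comp_assoc]
      simp

/-- Precomposition with an essentially surjective functor is faithful. -/
theorem faithful_whiskeringLeft_of_essSurj {A B D : Type*} [Category* A] [Category* B]
    [Category* D] (L : A ⥤ B) [L.EssSurj] :
    ((Functor.whiskeringLeft A B D).obj L).Faithful where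
  map_injective {G H} φ ψ h := by
    ext Y
    have : φ.app (L.obj (L.objPreimage Y)) = ψ.app (L.obj (L.objPreimage Y)) :=
      NatTrans.congr_app h (L.objPreimage Y)
    rw [← cancel_epi (G.map (L.objObjPreimageIso Y).hom), φ.naturality, ψ.naturality, this]

/-! ### Polynomial two-cocycles of the additive group -/

section Cocycle

/-- Elements of the `d`-th power of the span of two elements are binary forms of degree `d`. -/
theorem exists_binaryForm {R : Type*} [CommRing R] (x y : R) (d : ℕ) {f : R}
    (hf : f ∈ (Submodule.span ℤ {x, y}) ^ d) :
    ∃ a : ℕ → ℤ, f = ∑ k ∈ Finset.range (d + 1), (a k : R) * (x ^ k * y ^ (d - k)) := by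
  induction d generalizing f with
  | zero =>
    rw [pow_zero, Submodule.mem_one] at hf
    obtain ⟨n, rfl⟩ := hf
    exact ⟨fun _ => n, by simp⟩
  | succ d ih =>
    rw [pow_succ] at hf
    refine Submodule.mul_induction_on hf ?_ ?_
    · intro m hm n hn
      obtain ⟨a, rfl⟩ := ih hm
      obtain ⟨r, s, rfl⟩ := Submodule.mem_span_pair.mp hn
      refine ⟨fun k => (if k = 0 then 0 else r * a (k - 1)) + if k = d + 1 then 0 else s * a k, ?_⟩
      have hR : ∑ k ∈ Finset.range (d + 1 + 1),
          (((if k = 0 then 0 else r * a (k - 1) : ℤ)) : R) * (x ^ k * y ^ (d + 1 - k)) =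
          (∑ k ∈ Finset.range (d + 1), (a k : R) * (x ^ k * y ^ (d - k))) * (r • x) := by
        rw [Finset.sum_range_succ', Finset.sum_mul]
        simp only [if_true, Int.cast_zero, zero_mul, add_zero]
        refine Finset.sum_congr rfl fun k _ => ?_
        simp only [Nat.add_eq_zero_iff, one_ne_zero, and_false, if_false, Nat.add_sub_cancel,
          Nat.add_sub_add_right, zsmul_eq_mul]
        push_cast
        ring
      have hS : ∑ k ∈ Finset.range (d + 1 + 1),
          (((if k = d + 1 then 0 else s * a k : ℤ)) : R) * (x ^ k * y ^ (d + 1 - k)) =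
          (∑ k ∈ Finset.range (d + 1), (a k : R) * (x ^ k * y ^ (d - k))) * (s • y) := by
        rw [Finset.sum_range_succ, Finset.sum_mul]
        simp only [if_true, Int.cast_zero, zero_mul, add_zero]
        refine Finset.sum_congr rfl fun k hk => ?_
        have hk' := Finset.mem_range.mp hk
        rw [if_neg hk'.ne, Nat.succ_sub (by omega : k ≤ d), pow_succ]
        simp only [zsmul_eq_mul]
        push_cast
        ring
      simp only [Int.cast_add, add_mul, Finset.sum_add_distrib]
      rw [hR, hS, mul_add]
    · rintro f g ⟨a, rfl⟩ ⟨b, rfl⟩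
      refine ⟨a + b, ?_⟩
      rw [← Finset.sum_add_distrib]
      exact Finset.sum_congr rfl fun k _ => by simp only [Pi.add_apply]; push_cast; ring

open Polynomial in
/-- The coefficients of a binary form `f` of degree `d` with
`f(x + y, z) + f(x, y) = f(x, y + z) + f(y, z)`, where `a k` is the coefficient of
`x ^ k y ^ (d - k)`. The first relation is the identity at `x = y = 0`, and the others come from its part linear in `x`
at `y = 1`, which reads `k a_k = a_1 (d - 1 choose d - k)` for `0 < k < d`. -/
theorem coeff_of_cocycle {d : ℕ} (hd : 0 < d) (a : ℕ → ℤ)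
    (h : ∀ (R : Type) [CommRing R] (x y z : R),
      ∑ k ∈ Finset.range (d + 1), (a k : R) * ((x + y) ^ k * z ^ (d - k)) +
        ∑ k ∈ Finset.range (d + 1), (a k : R) * (x ^ k * y ^ (d - k)) =
      ∑ k ∈ Finset.range (d + 1), (a k : R) * (x ^ k * (y + z) ^ (d - k)) +
        ∑ k ∈ Finset.range (d + 1), (a k : R) * (y ^ k * z ^ (d - k))) :
    a 0 = 0 ∧ a d = 0 ∧ ∀ k, 0 < k → k < d → (d : ℤ) * a k = a 1 * d.choose k := by
  have h0 : a 0 = 0 := by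
    have := h ℤ 0 0 1
    rw [Finset.sum_eq_single 0, Finset.sum_eq_single 0, Finset.sum_eq_single 0,
      Finset.sum_eq_single 0] at this
    · simpa [hd.ne'] using this
    all_goals simp +contextual [hd.ne']
  have hpoly : ∑ k ∈ Finset.range (d + 1), (a k * k : ℤ[X]) * X ^ (d - k) + (a 1 : ℤ[X]) =
      (a 1 : ℤ[X]) * (1 + X) ^ (d - 1) := by
    have h1 := congrArg (fun q => Polynomial.coeff q 1) (h ℤ[X][X] X 1 (C X))
    have e2 : ∀ n : ℤ, ((n : ℤ[X][X]) = C (n : ℤ[X])) := fun n => by simp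
    have e3 : (1 : ℤ[X][X]) + C X = C (1 + X) := by simp
    simp only [e2, e3, ← C_pow, coeff_add, finsetSum_coeff, coeff_C_mul, coeff_mul_C,
      one_pow, mul_one, one_mul] at h1
    simp only [add_comm X (1 : ℤ[X][X]), coeff_one_add_X_pow, coeff_X_pow, coeff_C] at h1
    simpa [mul_assoc, hd] using h1
  have hcoeff : ∀ k ≤ d, a k * k + (if k = d then a 1 else 0) =
      a 1 * ((d - 1).choose (d - k) : ℤ) := by
    intro k hk
    have h1 := congrArg (fun q => Polynomial.coeff q (d - k)) hpoly
    have e2 : ∀ n : ℤ, ((n : ℤ[X]) = C (n : ℤ)) := fun n => by simp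
    have e4 : ∀ n : ℕ, ((n : ℤ[X]) = C (n : ℤ)) := fun n => by simp
    simp only [e2, e4, ← C_mul, coeff_add, finsetSum_coeff, coeff_C_mul, coeff_X_pow,
      coeff_one_add_X_pow, coeff_C] at h1
    rw [Finset.sum_eq_single k] at h1
    · have : (d - k = 0) ↔ k = d := by omega
      simpa [this] using h1
    · intro j hj hjk
      have := Finset.mem_range.mp hj
      rw [if_neg (by omega), mul_zero]
    · intro hk'
      exact absurd (Finset.mem_range.mpr (by omega)) hk'
  refine ⟨h0, ?_, ?_⟩
  · have := hcoeff d le_rfl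
    rw [if_pos rfl, Nat.sub_self, Nat.choose_zero_right, Nat.cast_one, mul_one,
      add_eq_right, mul_eq_zero] at this
    exact this.resolve_right (by exact_mod_cast hd.ne')
  · intro k hk hkd
    have h1 := hcoeff k hkd.le
    rw [if_neg hkd.ne, add_zero] at h1
    obtain ⟨e, rfl⟩ : ∃ e, d = e + 1 := ⟨d - 1, by omega⟩
    obtain ⟨j, rfl⟩ : ∃ j, k = j + 1 := ⟨k - 1, by omega⟩
    have h2 : (e + 1 - 1).choose (e + 1 - (j + 1)) = e.choose j := by
      rw [Nat.add_sub_cancel, Nat.add_sub_add_right, Nat.choose_symm (by omega)]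
    rw [h2] at h1
    have h3 : ((e : ℤ) + 1) * e.choose j = (e + 1).choose (j + 1) * (j + 1) := by
      exact_mod_cast Nat.add_one_mul_choose_eq e j
    have h4 : ((j : ℤ) + 1) ≠ 0 := by positivity
    apply mul_right_cancel₀ h4
    push_cast at h1 ⊢
    linear_combination (e + 1 : ℤ) * h1 + a 1 * h3

/-- The relations of `coeff_of_cocycle` for `d = p ^ l`, `l > 0`, make the form a multiple of
`((x + y) ^ d - x ^ d - y ^ d) / p`, as `d / p` divides `a 1`. -/
theorem exists_coeff_eq_mul_choose_div {p l : ℕ} [hp : Fact p.Prime] (hl : 0 < l) (a : ℕ → ℤ)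
    (h : ∀ k, 0 < k → k < p ^ l → ((p ^ l : ℕ) : ℤ) * a k = a 1 * (p ^ l).choose k) :
    ∃ m : ℤ, ∀ k, 0 < k → k < p ^ l → a k = m * ((p ^ l).choose k / p : ℕ) := by
  have hp0 : (p : ℤ) ≠ 0 := by exact_mod_cast hp.out.ne_zero
  obtain ⟨l, rfl⟩ : ∃ j, l = j + 1 := ⟨l - 1, by omega⟩
  have hdiv : ∀ k, 0 < k → k < p ^ (l + 1) →
      (((p ^ (l + 1)).choose k : ℕ) : ℤ) = p * ((p ^ (l + 1)).choose k / p : ℕ) := by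
    intro k hk hk'
    exact_mod_cast (Nat.mul_div_cancel' (hp.out.dvd_choose_pow hk.ne' hk'.ne)).symm
  have hlt : p ^ l < p ^ (l + 1) := Nat.pow_lt_pow_right hp.out.one_lt (Nat.lt_succ_self l)
  have hpos : 0 < p ^ l := pow_pos hp.out.pos l
  -- `(p ^ (l + 1) choose p ^ l)` has `p`-adic valuation one.
  have hcop : Nat.Coprime (p ^ l) ((p ^ (l + 1)).choose (p ^ l) / p) := by
    refine Nat.Coprime.pow_left l ((Nat.Prime.coprime_iff_not_dvd hp.out).mpr fun hdvd => ?_)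
    have h1 := Nat.mul_dvd_mul_left p hdvd
    rw [Nat.mul_div_cancel' (hp.out.dvd_choose_pow hpos.ne' hlt.ne), ← pow_two,
      hp.out.pow_dvd_iff_le_factorization (Nat.choose_pos hlt.le).ne',
      Nat.factorization_choose_prime_pow hp.out hlt.le hpos.ne',
      hp.out.factorization_pow, Finsupp.single_eq_same] at h1
    omega
  have key : ∀ k, 0 < k → k < p ^ (l + 1) →
      ((p ^ l : ℕ) : ℤ) * a k = a 1 * ((p ^ (l + 1)).choose k / p : ℕ) := by
    intro k hk hk'
    have := h k hk hk'
    rw [hdiv k hk hk', show ((p ^ (l + 1) : ℕ) : ℤ) = p * (p ^ l : ℕ) by push_cast; ring] at this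
    apply mul_left_cancel₀ hp0
    linear_combination this
  have hdvd : ((p ^ l : ℕ) : ℤ) ∣ a 1 :=
    (Nat.isCoprime_iff_coprime.mpr hcop).dvd_of_dvd_mul_right ⟨_, (key _ hpos hlt).symm⟩
  obtain ⟨m, hm⟩ := hdvd
  refine ⟨m, fun k hk hk' => ?_⟩
  have h1 := key k hk hk'
  rw [hm, mul_assoc] at h1
  exact mul_left_cancel₀ (by exact_mod_cast hpos.ne') h1

end Cocycle

/-! ### Abelianization as a functor -/

/-- The class in `G / [G, G]` of an element of `G`. -/
def abClass {G : Gr} (g : G.obj) : (abelianization.obj G).obj :=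
  Additive.ofMul (Abelianization.of (G := G.obj) g)

theorem abClass_mul {G : Gr} (g h : G.obj) : abClass (g * h) = abClass g + abClass h :=
  rfl

theorem abClass_surjective (G : Gr) : Function.Surjective (abClass (G := G)) := fun a => by
  obtain ⟨g, hg⟩ := QuotientGroup.mk_surjective (Additive.toMul a : Abelianization G.obj)
  exact ⟨g, congrArg Additive.ofMul hg⟩

/-- The free group on `n` generators as an object of `gr`. -/
def freeGr (n : ℕ) : Gr :=
  ⟨GrpCat.of (FreeGroup (Fin n)), inferInstanceAs (IsFreeGroup (FreeGroup (Fin n))),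
    inferInstanceAs (Group.FG (FreeGroup (Fin n)))⟩

/-- The generators of `freeGr n`. -/
def gen {n : ℕ} (i : Fin n) : (freeGr n).obj := FreeGroup.of i

/-- The homomorphism from a free group with prescribed values on the generators. -/
def freeGr.lift {n : ℕ} {G : Gr} (v : Fin n → G.obj) : freeGr n ⟶ G :=
  ObjectProperty.homMk (GrpCat.ofHom (FreeGroup.lift v))

theorem freeGr.lift_gen {n : ℕ} {G : Gr} (v : Fin n → G.obj) (i : Fin n) :
    (freeGr.lift v).hom.hom (gen i) = v i :=
  FreeGroup.lift_apply_of

theorem freeGr.hom_ext {n : ℕ} {G : Gr} {φ ψ : freeGr n ⟶ G}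
    (h : ∀ i, φ.hom.hom (gen i) = ψ.hom.hom (gen i)) : φ = ψ := by
  apply ObjectProperty.hom_ext
  exact GrpCat.hom_ext (FreeGroup.ext_hom _ _ h)

/-- The homomorphism from the abelianization of a free group to an abelian group with prescribed
values on the generators. -/
def freeGr.abLift {n : ℕ} {A : Type} [AddCommGroup A] (v : Fin n → A) :
    (abelianization.obj (freeGr n)).obj →+ A :=
  show Additive (Abelianization (FreeGroup (Fin n))) →+ A from MonoidHom.toAdditiveLeft
    (Abelianization.lift (FreeGroup.lift fun i => Multiplicative.ofAdd (v i)))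

theorem freeGr.abLift_abClass_gen {n : ℕ} {A : Type} [AddCommGroup A] (v : Fin n → A)
    (i : Fin n) : freeGr.abLift v (abClass (gen i)) = v i := by
  change Multiplicative.toAdd (Abelianization.lift (FreeGroup.lift fun i =>
    Multiplicative.ofAdd (v i)) (Abelianization.of (FreeGroup.of i))) = _
  rw [Abelianization.lift_apply_of, FreeGroup.lift_apply_of]
  rfl

theorem freeGr.abClass_mem_span {n : ℕ} (g : (freeGr n).obj) :
    abClass g ∈ Submodule.span ℤ (Set.range fun i : Fin n => abClass (gen i)) := by
  have hinv : ∀ g : (freeGr n).obj, abClass g⁻¹ = -abClass g := fun g => rfl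
  refine FreeGroup.induction_on (C := fun g => @abClass (freeGr n) g ∈ Submodule.span ℤ _)
    g ?_ ?_ ?_ ?_
  · exact Submodule.zero_mem _
  · exact fun i => Submodule.subset_span ⟨i, rfl⟩
  · intro i hi
    exact (hinv (gen i)) ▸ Submodule.neg_mem _ hi
  · intro x y hx hy
    exact (@abClass_mul (freeGr n) x y) ▸ Submodule.add_mem _ hx hy

theorem freeGr.range_ι (n : ℕ) :
    LinearMap.range (SymmetricAlgebra.ι ℤ (abelianization.obj (freeGr n)).obj) =
      Submodule.span ℤ (Set.range fun i : Fin n => SymmetricAlgebra.ι ℤ _ (abClass (gen i))) := by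
  have h : Submodule.span ℤ (Set.range fun i : Fin n => abClass (gen i)) = ⊤ := by
    refine (Submodule.eq_top_iff').mpr fun a => ?_
    obtain ⟨g, rfl⟩ := abClass_surjective _ a
    exact freeGr.abClass_mem_span g
  rw [LinearMap.range_eq_map, ← h, Submodule.map_span, ← Set.range_comp]
  rfl

instance : abelianization.Full where
  map_surjective {G H} f := by
    obtain ⟨ι, ⟨b⟩⟩ := G.property.1.nonempty_basis
    choose s hs using abClass_surjective H
    let v : ι → H.obj := fun i => s (f.hom.hom (abClass (b i)))
    refine ⟨ObjectProperty.homMk (GrpCat.ofHom (b.lift v)), ?_⟩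
    apply ObjectProperty.hom_ext
    refine AddCommGrpCat.hom_ext (AddMonoidHom.ext fun a => ?_)
    obtain ⟨g, rfl⟩ := abClass_surjective G a
    let p : G.obj →* Multiplicative (abelianization.obj H).obj :=
      { toFun := fun g => Multiplicative.ofAdd (abClass (b.lift v g))
        map_one' := by rw [map_one]; rfl
        map_mul' := fun g h => by rw [map_mul, abClass_mul]; rfl }
    let q : G.obj →* Multiplicative (abelianization.obj H).obj :=
      { toFun := fun g => Multiplicative.ofAdd (f.hom.hom (abClass g))
        map_one' := (congrArg Multiplicative.ofAdd (map_zero f.hom.hom))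
        map_mul' := fun g h => by rw [abClass_mul, map_add]; rfl }
    have hpq : p = q := b.ext_hom _ _ fun i => by
      change Multiplicative.ofAdd (abClass (b.lift v (b i))) = _
      rw [show b.lift v (b i) = v i from congrFun (b.lift.symm_apply_apply v) i]
      exact congrArg Multiplicative.ofAdd (hs _)
    exact congrArg Multiplicative.toAdd (DFunLike.congr_fun hpq g)

instance : abelianization.EssSurj where
  mem_essImage A := by
    obtain ⟨h1, h2⟩ := A.property
    let n := Module.finrank ℤ A.obj
    let b : Module.Basis (Fin n) ℤ A.obj := Module.finBasis ℤ A.obj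
    refine ⟨freeGr n, ⟨isFGFreeAb.isoMk (AddEquiv.toAddCommGrpIso
      (AddEquiv.ofBijective (freeGr.abLift b) ?_))⟩⟩
    let c : A.obj →+ (abelianization.obj (freeGr n)).obj :=
      (b.constr ℤ fun i => (abClass (gen i) : (abelianization.obj (freeGr n)).obj)).toAddMonoidHom
    have hc : ∀ i, c (b i) = abClass (gen i) := fun i => b.constr_basis ℤ _ i
    refine Function.bijective_iff_has_inverse.mpr ⟨c, fun a => ?_, fun a => ?_⟩
    · obtain ⟨g, rfl⟩ := abClass_surjective _ a
      refine Submodule.span_induction (p := fun a _ => c (freeGr.abLift b a) = a) ?_ ?_ ?_ ?_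
        (freeGr.abClass_mem_span g)
      · rintro _ ⟨i, rfl⟩
        simp only [freeGr.abLift_abClass_gen, hc]
      · simp
      · intro x y _ _ hx hy
        rw [map_add, map_add, hx, hy]
      · intro r x _ hx
        rw [map_zsmul, map_zsmul, hx]
    · have : (freeGr.abLift b).toIntLinearMap ∘ₗ c.toIntLinearMap = LinearMap.id :=
        b.ext fun i => by
          change freeGr.abLift b (c (b i)) = b i
          rw [hc, freeGr.abLift_abClass_gen]
      exact DFunLike.congr_fun this a

instance : precompAbelianization.Full := full_whiskeringLeft_of_full _

instance : precompAbelianization.Faithful := faithful_whiskeringLeft_of_essSurj _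

/-! ### The projective presentation of the abelianization functor -/

/-- The basis element `[g]` of the value at `G` of the functor represented by the free group on one
generator, which is the group ring `ℤ[G]`. -/
def bracket {G : Gr} (g : G.obj) : (freeYoneda (freeGr 1)).obj G :=
  freeYoneda.of (freeGr.lift fun _ => g)

theorem map_bracket {G H : Gr} (φ : G ⟶ H) (g : G.obj) :
    ((freeYoneda (freeGr 1)).map φ).hom (bracket g) = bracket (φ.hom.hom g) := by
  refine (freeYoneda.map_of _ _).trans (congrArg freeYoneda.of (freeGr.hom_ext fun i => ?_))
  rw [freeGr.lift_gen]
  exact congrArg φ.hom.hom (freeGr.lift_gen _ i)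

theorem desc_bracket {F : FGr} (t : F.obj (freeGr 1)) {G : Gr} (g : G.obj) :
    ((freeYoneda.desc t).app G).hom (bracket g) = (F.map (freeGr.lift fun _ => g)).hom t :=
  freeYoneda.desc_of _ _

theorem freeYoneda_freeGr_hom_ext {A : Type} [AddCommGroup A] {G : Gr}
    {φ ψ : (freeYoneda (freeGr 1)).obj G →+ A} (h : ∀ g, φ (bracket g) = ψ (bracket g)) :
    φ = ψ := by
  refine FreeAbelianGroup.lift_ext _ _ fun k => ?_
  have hk : k = freeGr.lift fun _ => k.hom.hom (gen 0) := freeGr.hom_ext fun i => by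
    rw [freeGr.lift_gen, Subsingleton.elim i 0]
  rw [hk]
  exact h _

/-- The natural map `ℤ[G] → G / [G, G]` that sends `[g]` to the class of `g`. -/
def bracketProj : freeYoneda (freeGr 1) ⟶ 𝔞 :=
  freeYoneda.desc (F := 𝔞) (abClass (gen 0))

theorem bracketProj_bracket {G : Gr} (g : G.obj) :
    (bracketProj.app G).hom (bracket g) = abClass g :=
  (desc_bracket (F := 𝔞) _ g).trans (congrArg abClass (freeGr.lift_gen (fun _ => g) 0))

instance : Epi bracketProj := by
  rw [NatTrans.epi_iff_epi_app]
  intro G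
  rw [AddCommGrpCat.epi_iff_surjective]
  intro a
  obtain ⟨g, rfl⟩ := abClass_surjective G a
  exact ⟨bracket g, bracketProj_bracket g⟩

/-- The presentation `0 → K → ℤ[-] → 𝔞 → 0`. -/
noncomputable def presentation : ShortComplex FGr :=
  ShortComplex.mk (kernel.ι bracketProj) bracketProj (kernel.condition _)

instance : Projective presentation.X₂ := freeYoneda.projective _

theorem presentation_shortExact : presentation.ShortExact where
  exact := ShortComplex.exact_kernel _
  mono_f := inferInstanceAs (Mono (kernel.ι bracketProj))
  epi_g := inferInstanceAs (Epi bracketProj)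

theorem presentation_f_injective (G : Gr) :
    Function.Injective (presentation.f.app G).hom := by
  have := presentation_shortExact.mono_f
  exact (AddCommGrpCat.mono_iff_injective _).mp inferInstance

theorem exists_presentation_f_eq {G : Gr} (z : (freeYoneda (freeGr 1)).obj G)
    (hz : (bracketProj.app G).hom z = 0) : ∃ k, (presentation.f.app G).hom k = z :=
  (ShortComplex.ab_exact_iff _).mp
    (presentation_shortExact.exact.map ((evaluation _ _).obj G)) z hz

theorem exists_cross {G : Gr} (g h : G.obj) :
    ∃ k, (presentation.f.app G).hom k = bracket (g * h) - (bracket g + bracket h) := by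
  refine exists_presentation_f_eq _ ?_
  rw [map_sub, map_add, bracketProj_bracket, bracketProj_bracket, bracketProj_bracket,
    abClass_mul]
  exact sub_self _

/-- The element `[gh] - [g] - [h]` of `K(G)`. -/
noncomputable def cross {G : Gr} (g h : G.obj) : presentation.X₁.obj G :=
  (exists_cross g h).choose

theorem presentation_f_cross {G : Gr} (g h : G.obj) :
    (presentation.f.app G).hom (cross g h) = bracket (g * h) - (bracket g + bracket h) :=
  (exists_cross g h).choose_spec

theorem map_cross {G H : Gr} (φ : G ⟶ H) (g h : G.obj) :
    (presentation.X₁.map φ).hom (cross g h) = cross (φ.hom.hom g) (φ.hom.hom h) := by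
  apply presentation_f_injective
  have := ConcreteCategory.congr_hom (presentation.f.naturality φ) (cross g h)
  refine this.trans ?_
  change ((freeYoneda (freeGr 1)).map φ).hom ((presentation.f.app G).hom (cross g h)) = _
  rw [presentation_f_cross, presentation_f_cross, map_sub, map_add, map_bracket, map_bracket,
    map_bracket, map_mul]

/-- The two-cocycle identity. -/
theorem cross_cocycle {G : Gr} (x y z : G.obj) :
    cross (x * y) z + cross x y = cross x (y * z) + cross y z := by
  apply presentation_f_injective
  rw [map_add, map_add]
  simp only [presentation_f_cross, mul_assoc]
  abel

/-- The group `K(G)` is generated by the elements `[gh] - [g] - [h]`: modulo these, `g ↦ [g]` is a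
homomorphism, hence factors through the abelianization. -/
theorem closure_cross (G : Gr) :
    AddSubgroup.closure (Set.range fun x : G.obj × G.obj => cross x.1 x.2) = ⊤ := by
  rw [AddSubgroup.eq_top_iff']
  intro k
  let N : AddSubgroup ((freeYoneda (freeGr 1)).obj G) :=
    AddSubgroup.closure (Set.range fun x : G.obj × G.obj =>
      bracket (x.1 * x.2) - (bracket x.1 + bracket x.2))
  have hadd : ∀ g h : G.obj, (QuotientAddGroup.mk' N) (bracket (g * h)) =
      QuotientAddGroup.mk' N (bracket g) + QuotientAddGroup.mk' N (bracket h) := by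
    intro g h
    rw [← map_add, ← sub_eq_zero, ← map_sub]
    exact (QuotientAddGroup.eq_zero_iff _).mpr (AddSubgroup.subset_closure ⟨(g, h), rfl⟩)
  let p : G.obj →* Multiplicative ((freeYoneda (freeGr 1)).obj G ⧸ N) :=
    MonoidHom.mk' (fun g => Multiplicative.ofAdd (QuotientAddGroup.mk' N (bracket g))) hadd
  let q : (𝔞.obj G) →+ (freeYoneda (freeGr 1)).obj G ⧸ N :=
    show Additive (Abelianization G.obj) →+ _ from MonoidHom.toAdditiveLeft (Abelianization.lift p)
  have hq : q.comp (bracketProj.app G).hom = QuotientAddGroup.mk' N :=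
    freeYoneda_freeGr_hom_ext fun g => congrArg q (bracketProj_bracket g)
  have hker : ∀ z : (freeYoneda (freeGr 1)).obj G, (bracketProj.app G).hom z = 0 → z ∈ N := by
    intro z hz
    have h1 : QuotientAddGroup.mk' N z = 0 :=
      (DFunLike.congr_fun hq z).symm.trans ((congrArg q hz).trans (map_zero q))
    exact (QuotientAddGroup.eq_zero_iff _).mp h1
  have hk : (presentation.f.app G).hom k ∈ N :=
    hker _ (ConcreteCategory.congr_hom (NatTrans.congr_app presentation.zero G) k)
  have hN : N ≤ (AddSubgroup.closure (Set.range fun x : G.obj × G.obj =>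
      cross x.1 x.2)).map (presentation.f.app G).hom := by
    refine (AddSubgroup.closure_le _).mpr ?_
    rintro _ ⟨x, rfl⟩
    exact ⟨cross x.1 x.2, AddSubgroup.subset_closure ⟨x, rfl⟩, presentation_f_cross _ _⟩
  obtain ⟨k', hk', h⟩ := hN hk
  exact presentation_f_injective G h ▸ hk'

theorem presentation_hom_ext {F : FGr} {φ ψ : presentation.X₁ ⟶ F}
    (H : ∀ (G : Gr) (g h : G.obj), (φ.app G).hom (cross g h) = (ψ.app G).hom (cross g h)) :
    φ = ψ := by
  ext G : 2
  refine AddCommGrpCat.hom_ext (AddMonoidHom.eq_of_eqOn_dense (closure_cross G) ?_)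
  rintro _ ⟨x, rfl⟩
  exact H G x.1 x.2

/-! ### The first extension group with values in a symmetric power -/

/-- The generator `ι(a)` of the symmetric algebra of `G / [G, G]`, where `a` is the class of `g`. -/
noncomputable def symClass {G : Gr} (g : G.obj) :
    SymmetricAlgebra ℤ (abelianization.obj G).obj :=
  SymmetricAlgebra.ι ℤ _ (abClass g)

theorem symPow_freeGr (n d : ℕ) : symPow d (abelianization.obj (freeGr n)).obj =
    Submodule.span ℤ (Set.range fun i : Fin n => symClass (gen i)) ^ d :=
  congrArg (· ^ d) (freeGr.range_ι n)

theorem symClass_mul {G : Gr} (g h : G.obj) :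
    symClass (g * h) = symClass g + symClass h :=
  (congrArg _ (abClass_mul g h)).trans (map_add _ _ _)

theorem symMap_symClass {G H : Gr} (φ : G ⟶ H) (g : G.obj) :
    symMap (abelianization.map φ).hom.hom (symClass g) = symClass (φ.hom.hom g) :=
  symMap_ι _ _

/-- Every homomorphism from the free group on `n` generators to a commutative ring extends over
the symmetric algebra of its abelianization. -/
theorem exists_algHom_symClass_gen {n : ℕ} {R : Type} [CommRing R] (v : Fin n → R) :
    ∃ χ : SymmetricAlgebra ℤ (abelianization.obj (freeGr n)).obj →ₐ[ℤ] R,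
      ∀ i, χ (symClass (gen i)) = v i :=
  ⟨SymmetricAlgebra.lift (freeGr.abLift v).toIntLinearMap, fun i =>
    (SymmetricAlgebra.lift_ι_apply _ _).trans (freeGr.abLift_abClass_gen v i)⟩

theorem val_map_S {d : ℕ} {G H : Gr} (φ : G ⟶ H) (x : (abelianization ⋙ S d).obj G) :
    (((abelianization ⋙ S d).map φ).hom x).1 = symMap (abelianization.map φ).hom.hom x.1 := rfl

/-- A natural transformation `K ⟶ S^d ∘ 𝔞` is given on the elements `[gh] - [g] - [h]` by a binary
form of degree `d`. -/
theorem exists_binaryForm_cross {d : ℕ} (φ : presentation.X₁ ⟶ abelianization ⋙ S d) :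
    ∃ a : ℕ → ℤ, ∀ (G : Gr) (g h : G.obj), ((φ.app G).hom (cross g h)).1 =
      ∑ k ∈ Finset.range (d + 1), (a k : SymmetricAlgebra ℤ (abelianization.obj G).obj) *
        (symClass g ^ k * symClass h ^ (d - k)) := by
  let f : symPow d (abelianization.obj (freeGr 2)).obj :=
    (φ.app (freeGr 2)).hom (cross (gen 0) (gen 1))
  have hf : f.1 ∈ Submodule.span ℤ {symClass (G := freeGr 2) (gen 0), symClass (gen 1)} ^ d := by
    have h : (Set.range fun i : Fin 2 => symClass (gen i)) =
        {symClass (G := freeGr 2) (gen 0), symClass (gen 1)} := by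
      ext x
      simp [Fin.exists_fin_two, eq_comm]
    exact h ▸ (symPow_freeGr 2 d).le f.2
  obtain ⟨a, ha⟩ := exists_binaryForm _ _ d hf
  refine ⟨a, fun G g h => ?_⟩
  let θ : freeGr 2 ⟶ G := freeGr.lift ![g, h]
  have h0 : θ.hom.hom (gen 0) = g := freeGr.lift_gen _ _
  have h1 : θ.hom.hom (gen 1) = h := freeGr.lift_gen _ _
  have hnat := ConcreteCategory.congr_hom (φ.naturality θ) (cross (gen 0) (gen 1))
  have hnat' : (φ.app G).hom ((presentation.X₁.map θ).hom (cross (gen 0) (gen 1))) =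
    ((abelianization ⋙ S d).map θ).hom f := hnat
  rw [map_cross, h0, h1] at hnat'
  rw [hnat', val_map_S, ha, map_sum]
  refine Finset.sum_congr rfl fun k _ => ?_
  rw [map_mul, map_intCast, map_mul, map_pow, map_pow, symMap_symClass, symMap_symClass, h0, h1]

theorem sum_range_succ_eq_Ioo {M : Type*} [AddCommMonoid M] {d : ℕ} (hd : 0 < d) (f : ℕ → M) :
    ∑ k ∈ Finset.range (d + 1), f k = f 0 + f d + ∑ k ∈ Finset.Ioo 0 d, f k := by
  have h : Finset.range (d + 1) = insert 0 (insert d (Finset.Ioo 0 d)) := by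
    ext k
    simp only [Finset.mem_range, Finset.mem_insert, Finset.mem_Ioo]
    omega
  rw [h, Finset.sum_insert (by simp [hd.ne]), Finset.sum_insert (by simp), add_assoc]

/-- The expansion of `(x + y) ^ d` without its two pure powers. -/
theorem add_pow_eq_sum_Ioo {R : Type*} [CommRing R] {d : ℕ} (hd : 0 < d) (x y : R) :
    (x + y) ^ d = x ^ d + y ^ d +
      ∑ k ∈ Finset.Ioo 0 d, (d.choose k : R) * (x ^ k * y ^ (d - k)) := by
  rw [add_pow, sum_range_succ_eq_Ioo hd]
  refine congrArg₂ _ (by simp [add_comm]) (Finset.sum_congr rfl fun k _ => mul_comm _ _)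

theorem exists_binaryForm_cross_Ioo {d : ℕ} (hd : 0 < d)
    (φ : presentation.X₁ ⟶ abelianization ⋙ S d) :
    ∃ a : ℕ → ℤ, (∀ k, 0 < k → k < d → (d : ℤ) * a k = a 1 * d.choose k) ∧
      ∀ (G : Gr) (g h : G.obj), ((φ.app G).hom (cross g h)).1 =
        ∑ k ∈ Finset.Ioo 0 d, (a k : SymmetricAlgebra ℤ (abelianization.obj G).obj) *
          (symClass g ^ k * symClass h ^ (d - k)) := by
  obtain ⟨a, ha⟩ := exists_binaryForm_cross φ
  obtain ⟨h0, h1, h2⟩ := coeff_of_cocycle hd a fun R _ x y z => by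
    obtain ⟨χ, hχ⟩ := exists_algHom_symClass_gen ![x, y, z]
    have hx : χ (symClass (gen 0)) = x := hχ 0
    have hy : χ (symClass (gen 1)) = y := hχ 1
    have hz : χ (symClass (gen 2)) = z := hχ 2
    have h := congrArg (fun k => χ ((φ.app (freeGr 3)).hom k).1)
      (cross_cocycle (G := freeGr 3) (gen 0) (gen 1) (gen 2))
    simp only [map_add] at h
    erw [map_add, map_add] at h
    simpa only [ha, symClass_mul, map_sum, map_mul, map_add, map_pow, map_intCast, hx, hy, hz]
      using h
  refine ⟨a, h2, fun G g h => ?_⟩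
  rw [ha, sum_range_succ_eq_Ioo hd, h0, h1, Int.cast_zero, zero_mul, zero_mul, zero_add, zero_add]

/-- The natural transformation `ℤ[G] → S^d(G / [G, G])` that sends `[g]` to the `d`-th power of the
class of `g`. -/
noncomputable def powHom (d : ℕ) : presentation.X₂ ⟶ abelianization ⋙ S d :=
  freeYoneda.desc (F := abelianization ⋙ S d)
    (⟨_, ι_pow_mem d (abClass (gen 0))⟩ : symPow d (abelianization.obj (freeGr 1)).obj)

theorem val_powHom_bracket (d : ℕ) {G : Gr} (g : G.obj) :
    (((powHom d).app G).hom (bracket g)).1 = symClass g ^ d := by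
  refine (congrArg Subtype.val (desc_bracket (F := abelianization ⋙ S d) _ g)).trans ?_
  have h : symMap (abelianization.map (freeGr.lift (n := 1) fun _ => g)).hom.hom
      (symClass (gen 0)) = symClass g :=
    (symMap_symClass _ _).trans (congrArg symClass (freeGr.lift_gen _ _))
  rw [← h]
  exact map_pow (symMap (abelianization.map (freeGr.lift fun _ => g)).hom.hom)
    (symClass (gen 0)) d

theorem val_powHom_cross (d : ℕ) {G : Gr} (g h : G.obj) :
    (((presentation.f ≫ powHom d).app G).hom (cross g h)).1 =
      (symClass g + symClass h) ^ d - (symClass g ^ d + symClass h ^ d) := by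
  have h1 : ((presentation.f ≫ powHom d).app G).hom (cross g h) =
      ((powHom d).app G).hom (bracket (g * h)) -
        (((powHom d).app G).hom (bracket g) + ((powHom d).app G).hom (bracket h)) := by
    change ((powHom d).app G).hom ((presentation.f.app G).hom (cross g h)) = _
    rw [presentation_f_cross]
    exact (map_sub _ _ _).trans (congrArg₂ _ rfl (map_add _ _ _))
  rw [h1, ← symClass_mul, ← val_powHom_bracket, ← val_powHom_bracket, ← val_powHom_bracket]
  rfl

/-- The equality `m φ = n ψ` of natural transformations `K ⟶ S^d ∘ 𝔞` can be tested on the elements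
`[gh] - [g] - [h]`. -/
theorem zsmul_eq_zsmul_of_cross {d : ℕ} {φ ψ : presentation.X₁ ⟶ abelianization ⋙ S d} {m n : ℤ}
    (H : ∀ (G : Gr) (g h : G.obj),
      (m : SymmetricAlgebra ℤ (abelianization.obj G).obj) * ((φ.app G).hom (cross g h)).1 =
        n * ((ψ.app G).hom (cross g h)).1) : m • φ = n • ψ := by
  refine presentation_hom_ext fun G g h => Subtype.ext ?_
  have h1 := H G g h
  rw [← zsmul_eq_mul, ← zsmul_eq_mul] at h1
  exact h1

/-- The class in `Ext¹(𝔞, S^d ∘ 𝔞)` of a natural transformation `φ : K ⟶ S^d ∘ 𝔞`, that is, of the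
two-cocycle to which `φ` sends `[gh] - [g] - [h]`: the pushout of the presentation along `φ`. -/
noncomputable abbrev cocycleClass {d : ℕ} :
    (presentation.X₁ ⟶ abelianization ⋙ S d) →+ Ext 𝔞 (abelianization ⋙ S d) 1 :=
  compMk₀ (X := 𝔞) presentation_shortExact.extClass (abelianization ⋙ S d)

theorem exists_cocycleClass_eq {d : ℕ} (α : Ext 𝔞 (abelianization ⋙ S d) 1) :
    ∃ φ, cocycleClass φ = α := by
  obtain ⟨φ, hφ⟩ := exists_eq_extClass_comp_mk₀ presentation_shortExact α
  exact ⟨φ, hφ.symm⟩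

theorem cocycleClass_powHom (d : ℕ) : cocycleClass (presentation.f ≫ powHom d) = 0 :=
  (extClass_comp_mk₀_eq_zero_iff presentation_shortExact _).mpr ⟨_, rfl⟩

/-- The group `Ext¹(𝔞, S^d ∘ 𝔞)` is killed by `d`. -/
theorem zsmul_ext_eq_zero {d : ℕ} (hd : 0 < d) (α : Ext 𝔞 (abelianization ⋙ S d) 1) :
    (d : ℤ) • α = 0 := by
  obtain ⟨φ, rfl⟩ := exists_cocycleClass_eq α
  obtain ⟨a, h1, h2⟩ := exists_binaryForm_cross_Ioo hd φ
  have h3 : (d : ℤ) • φ = a 1 • (presentation.f ≫ powHom d) := by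
    refine zsmul_eq_zsmul_of_cross fun G g h => ?_
    rw [val_powHom_cross, add_pow_eq_sum_Ioo hd, add_sub_cancel_left, h2, Finset.mul_sum,
      Finset.mul_sum]
    refine Finset.sum_congr rfl fun k hk => ?_
    obtain ⟨hk0, hk1⟩ := Finset.mem_Ioo.mp hk
    rw [← mul_assoc, ← Int.cast_mul, h1 k hk0 hk1, Int.cast_mul, Int.cast_natCast, mul_assoc]
  rw [← map_zsmul, h3, map_zsmul, cocycleClass_powHom, smul_zero]

/-! ### Comparison of `ab` and `gr` -/

instance mono_zsmul_S (d : ℕ) (n : ℤ) [NeZero n] : Mono (n • 𝟙 (S d)) := by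
  rw [NatTrans.mono_iff_mono_app]
  intro V
  rw [AddCommGrpCat.mono_iff_injective]
  have := V.property.1
  refine (injective_iff_map_eq_zero (AddCommGrpCat.Hom.hom ((n • 𝟙 (S d)).app V))).mpr ?_
  intro x hx
  have h1 : n • (x.1 : SymmetricAlgebra ℤ V.obj) = 0 := congrArg Subtype.val hx
  exact Subtype.ext ((smul_eq_zero.mp h1).resolve_left (NeZero.ne n))

/-- The group `ℤ` as an object of `ab`. -/
def intAb : Ab :=
  ⟨AddCommGrpCat.of ℤ, inferInstanceAs (Module.Free ℤ ℤ), inferInstanceAs (Module.Finite ℤ ℤ)⟩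

/-- The natural map `ℤ[A] → A` in `F(ab; ℤ)`. -/
def bracketProjAb : freeYoneda intAb ⟶ I := freeYoneda.desc (F := I) (1 : ℤ)

instance : Epi bracketProjAb := by
  rw [NatTrans.epi_iff_epi_app]
  intro A
  rw [AddCommGrpCat.epi_iff_surjective]
  intro a
  refine ⟨freeYoneda.of (ObjectProperty.homMk (AddCommGrpCat.ofHom
    (zmultiplesHom A.obj a))), ?_⟩
  exact (freeYoneda.desc_of (F := I) _ _).trans (one_zsmul a)

/-- The comparison map is injective as precomposition is fully faithful, and surjective as its
target is torsion. -/
theorem bijective_mapExtAddHom {d : ℕ} (hd : 0 < d) :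
    Function.Bijective (precompAbelianization.mapExtAddHom I (S d) 1) := by
  constructor
  · let T := ShortComplex.mk (kernel.ι bracketProjAb) bracketProjAb (kernel.condition _)
    have hT : T.ShortExact := { exact := ShortComplex.exact_kernel _ }
    have : Projective T.X₂ := freeYoneda.projective _
    exact mapExtAddHom_one_injective precompAbelianization hT (S d)
  · intro α
    have : NeZero (d : ℤ) := ⟨by exact_mod_cast hd.ne'⟩
    exact exists_mapExtAddHom_one_eq precompAbelianization (d : ℤ) α (zsmul_ext_eq_zero hd α)

/-! ### The extension `E_d` -/

section Ed

variable (p l : ℕ) [hp : Fact p.Prime]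

theorem EdIncl_injective {A : Type} [AddCommGroup A] [Module.Free ℤ A] :
    Function.Injective (EdIncl p l A) := by
  rw [injective_iff_map_eq_zero]
  intro x hx
  have h1 : (p : ℤ) • (x.1 : SymmetricAlgebra ℤ A) = 0 :=
    (natCast_zsmul _ _).trans (congrArg (fun z => z.1.1.1) hx)
  exact Subtype.ext ((smul_eq_zero.mp h1).resolve_left (by exact_mod_cast hp.out.ne_zero))

theorem extensionSeq_shortExact : (extensionSeq p l).ShortExact where
  exact := exact_of_exact_evaluation fun V => (ShortComplex.ab_exact_iff _).mpr (by
    rintro ⟨⟨x, a⟩, y, hy⟩ (h : a = 0)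
    subst h
    refine ⟨y, Subtype.ext (Prod.ext (Subtype.ext ?_) rfl)⟩
    refine Eq.trans ?_ hy.symm
    rw [map_zero, zero_pow (pow_ne_zero _ hp.out.ne_zero), zero_add]
    rfl)
  mono_f := by
    rw [NatTrans.mono_iff_mono_app]
    intro V
    rw [AddCommGrpCat.mono_iff_injective]
    have := V.property.1
    exact EdIncl_injective p l
  epi_g := by
    rw [NatTrans.epi_iff_epi_app]
    intro V
    rw [AddCommGrpCat.epi_iff_surjective]
    exact fun a => ⟨EdDiag p l a, rfl⟩

theorem extensionSeqGr_shortExact : (extensionSeqGr p l).ShortExact :=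
  (extensionSeq_shortExact p l).map_of_exact precompAbelianization

/-- The lift `[g] ↦ (g ^ d, g)` of the presentation of `𝔞` to `E_d ∘ 𝔞`. -/
noncomputable def diagHom : presentation.X₂ ⟶ (extensionSeqGr p l).X₂ :=
  freeYoneda.desc (F := abelianization ⋙ E p l) (EdDiag p l (abClass (gen 0)))

theorem diagHom_bracket {G : Gr} (g : G.obj) :
    ((diagHom p l).app G).hom (bracket g) = EdDiag p l (abClass g) := by
  refine (desc_bracket (F := abelianization ⋙ E p l) _ g).trans ?_
  refine (EdMap_EdDiag p l _ _).trans (congrArg (EdDiag p l) ?_)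
  exact congrArg abClass (freeGr.lift_gen _ _)

theorem diagHom_comp : diagHom p l ≫ (extensionSeqGr p l).g = presentation.g := by
  ext G : 2
  refine AddCommGrpCat.hom_ext (freeYoneda_freeGr_hom_ext fun g => ?_)
  refine Eq.trans ?_ (bracketProj_bracket g).symm
  exact congrArg (EdProj p l _) (diagHom_bracket p l g)

/-- The class of the extension `E_d ∘ 𝔞`. -/
noncomputable def extensionClass : Ext 𝔞 (abelianization ⋙ S (p ^ l)) 1 :=
  (extensionSeqGr_shortExact p l).extClass

/-- The class of `E_d` is that of the two-cocycle `((x + y) ^ d - x ^ d - y ^ d) / p`. -/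
theorem exists_mixed_cocycle : ∃ φ : presentation.X₁ ⟶ abelianization ⋙ S (p ^ l),
    (∀ (G : Gr) (g h : G.obj),
      (φ.app G).hom (cross g h) = mixed p (p ^ l) (abClass g) (abClass h)) ∧
    cocycleClass φ = extensionClass p l := by
  have hS := extensionSeqGr_shortExact p l
  have := hS.mono_f
  have h0 : (presentation.f ≫ diagHom p l) ≫ (extensionSeqGr p l).g = 0 :=
    (Category.assoc _ _ _).trans ((congrArg _ (diagHom_comp p l)).trans presentation.zero)
  let φ := hS.exact.lift _ h0
  have hφ : φ ≫ (extensionSeqGr p l).f = presentation.f ≫ diagHom p l := hS.exact.lift_f _ h0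
  refine ⟨φ, fun G g h => ?_, ?_⟩
  · have := (abelianization.obj G).property.1
    apply EdIncl_injective p l
    have h1 := ConcreteCategory.congr_hom (NatTrans.congr_app hφ G) (cross g h)
    refine h1.trans ?_
    change ((diagHom p l).app G).hom ((presentation.f.app G).hom (cross g h)) = _
    rw [presentation_f_cross]
    refine (map_sub _ _ _).trans ?_
    refine (congrArg₂ _ rfl (map_add _ _ _)).trans ?_
    rw [diagHom_bracket, diagHom_bracket, diagHom_bracket, abClass_mul, EdDiag_add]
    exact add_sub_cancel_right _ _
  · let Θ : presentation ⟶ extensionSeqGr p l :=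
      { τ₁ := φ
        τ₂ := diagHom p l
        τ₃ := 𝟙 𝔞
        comm₁₂ := hφ
        comm₂₃ := (diagHom_comp p l).trans (Category.comp_id _).symm }
    have h1 := ShortComplex.ShortExact.extClass_naturality presentation_shortExact hS Θ
    exact h1.trans (Ext.mk₀_id_comp _)

theorem nsmul_extensionClass_eq_zero : p • extensionClass p l = 0 := by
  obtain ⟨φ, h1, h2⟩ := exists_mixed_cocycle p l
  have h3 : (p : ℤ) • φ = (1 : ℤ) • (presentation.f ≫ powHom (p ^ l)) := by
    refine zsmul_eq_zsmul_of_cross fun G g h => ?_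
    have h4 := ι_add_pow p l (abClass g) (abClass h)
    rw [map_add] at h4
    rw [val_powHom_cross, h1, symClass, symClass, h4, Int.cast_one, one_mul, add_sub_cancel_left,
      nsmul_eq_mul, Int.cast_natCast]
  rw [← h2, ← natCast_zsmul, ← map_zsmul, h3, one_smul, cocycleClass_powHom]

variable {l} (hl : 0 < l)

include hl in
theorem exists_zsmul_extensionClass_eq (α : Ext 𝔞 (abelianization ⋙ S (p ^ l)) 1) :
    ∃ m : ℤ, m • extensionClass p l = α := by
  have hd : 0 < p ^ l := pow_pos hp.out.pos l
  obtain ⟨ψ, rfl⟩ := exists_cocycleClass_eq α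
  obtain ⟨φ, h1, h2⟩ := exists_mixed_cocycle p l
  obtain ⟨a, h3, h4⟩ := exists_binaryForm_cross_Ioo hd ψ
  obtain ⟨m, hm⟩ := exists_coeff_eq_mul_choose_div hl a h3
  refine ⟨m, ?_⟩
  rw [← h2, ← map_zsmul, ← one_zsmul ψ]
  refine congrArg _ (zsmul_eq_zsmul_of_cross fun G g h => ?_)
  rw [h1, h4, mixed, Finset.mul_sum, Int.cast_one, one_mul]
  refine Finset.sum_congr rfl fun k hk => ?_
  obtain ⟨hk0, hk1⟩ := Finset.mem_Ioo.mp hk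
  rw [hm k hk0 hk1, nsmul_eq_mul, Int.cast_mul, mul_assoc, Int.cast_natCast]
  rfl

include hl in
/-- The extension does not split over `gr`: the image `(x, e)` of the generator `e` of `ℤ`
under a section would satisfy `S^d(2) x = 2 x`, that is `2 ^ d x = 2 x`, although `x ≡ e ^ d`
modulo `p`. -/
theorem extensionClass_ne_zero : extensionClass p l ≠ 0 := by
  intro h0
  obtain ⟨s, hs⟩ := exists_section_of_extClass_eq_zero (extensionSeqGr_shortExact p l) h0
  let G := freeGr 1
  let e : (abelianization.obj G).obj := abClass (gen 0)
  let z : EdGroup p l (abelianization.obj G).obj := (s.app G).hom e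
  have hz : z.1.2 = e := ConcreteCategory.congr_hom (NatTrans.congr_app hs G) e
  let θ : G ⟶ G := freeGr.lift fun _ => gen 0 * gen 0
  have hθ : (abelianization.map θ).hom.hom e = e + e :=
    (congrArg abClass (freeGr.lift_gen (fun _ => gen 0 * gen 0) 0)).trans (abClass_mul _ _)
  have hnat : EdMap p l (abelianization.map θ).hom.hom z = z + z := by
    have h1 := ConcreteCategory.congr_hom (s.naturality θ) e
    refine h1.symm.trans ?_
    change (s.app G).hom ((abelianization.map θ).hom.hom e) = _
    rw [hθ]
    exact map_add _ _ _
  obtain ⟨χ, hχ⟩ := exists_algHom_symClass_gen (n := 1) (R := ℤ) fun _ => 1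
  have hχe : χ (symClass (gen 0)) = 1 := hχ 0
  -- The group `S^d(ℤ)` is generated by `e ^ d`, which `S^d(2)` multiplies by `2 ^ d`.
  have hpow : ∀ x ∈ symPow (p ^ l) (abelianization.obj G).obj,
      χ (symMap (abelianization.map θ).hom.hom x) = 2 ^ p ^ l * χ x := by
    intro x hx
    have hx' := (symPow_freeGr 1 (p ^ l)).le hx
    rw [Set.range_unique, Submodule.span_pow, Set.singleton_pow,
      Submodule.mem_span_singleton] at hx'
    obtain ⟨r, rfl⟩ := hx'
    have h1 : (θ.hom.hom (gen 0)) = gen 0 * gen 0 := freeGr.lift_gen _ _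
    have h2 : χ (symMap (abelianization.map θ).hom.hom (symClass (gen 0))) = 2 := by
      rw [symMap_symClass, h1, symClass_mul, map_add, hχe]
      norm_num
    have h3 : χ (symClass (gen (default : Fin 1))) = 1 := hχe
    have h4 : χ (symMap (abelianization.map θ).hom.hom (symClass (gen (default : Fin 1)))) = 2 := h2
    rw [map_zsmul, map_pow, map_zsmul, map_pow, map_zsmul, map_pow, h3, h4, one_pow]
    simp [mul_comm]
  have h1 : χ (symMap (abelianization.map θ).hom.hom z.1.1.1) = χ z.1.1.1 + χ z.1.1.1 := by
    rw [← map_add]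
    exact congrArg χ (congrArg (fun w => w.1.1.1) hnat)
  rw [hpow _ z.1.1.2] at h1
  obtain ⟨y, hy⟩ := z.2
  have h2 : χ z.1.1.1 = 1 + p * χ y.1 := by
    rw [hy, hz, map_add, map_pow, map_nsmul, nsmul_eq_mul]
    have : χ (SymmetricAlgebra.ι ℤ (abelianization.obj G).obj e) = 1 := hχe
    rw [this, one_pow]
  have h3 : χ z.1.1.1 ≠ 0 := by
    intro h
    rw [h] at h2
    have : (p : ℤ) ∣ 1 := ⟨-χ y.1, by linear_combination -h2⟩
    exact hp.out.one_lt.ne' (by exact_mod_cast Int.eq_one_of_dvd_one (by positivity) this)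
  have h4 : (2 : ℤ) ^ p ^ l = 2 ^ 1 := mul_right_cancel₀ h3 (by linear_combination h1)
  have h5 : p ^ l = 1 := Int.pow_right_injective (by norm_num) h4
  exact (Nat.one_lt_pow hl.ne' hp.out.one_lt).ne' h5

include hl in
theorem zmultiples_extensionClass_eq_top :
    AddSubgroup.zmultiples (extensionClass p l) = ⊤ :=
  (AddSubgroup.eq_top_iff' _).mpr fun α =>
    AddSubgroup.mem_zmultiples_iff.mpr (exists_zsmul_extensionClass_eq p hl α)

include hl in
theorem nonempty_ext_addEquiv_zmod :
    Nonempty (Ext 𝔞 (abelianization ⋙ S (p ^ l)) 1 ≃+ ZMod p) := by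
  have hc : ∀ α, α ∈ AddSubgroup.zmultiples (extensionClass p l) := fun α =>
    (zmultiples_extensionClass_eq_top p hl).symm ▸ AddSubgroup.mem_top α
  have hcyc : IsAddCyclic (Ext 𝔞 (abelianization ⋙ S (p ^ l)) 1) := ⟨_, hc⟩
  have hcard : Nat.card (Ext 𝔞 (abelianization ⋙ S (p ^ l)) 1) = p :=
    (addOrderOf_eq_card_of_forall_mem_zmultiples hc).symm.trans
      (addOrderOf_eq_prime (nsmul_extensionClass_eq_zero p l) (extensionClass_ne_zero p hl))
  exact ⟨(zmodAddCyclicAddEquiv hcyc).symm.trans (ZMod.ringEquivCongr hcard).toAddEquiv⟩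

end Ed

end FunctorExt

open FunctorExt
theorem corollary202508041451 :
    (∀ d : ℕ, 0 < d →
      Function.Bijective (precompAbelianization.mapExtAddHom I (S d) 1 :
        Ext I (S d) 1 →+ Ext 𝔞 (abelianization ⋙ S d) 1)) ∧
    (∀ (p l : ℕ) [Fact p.Prime], 0 < l →
      Nonempty (Ext 𝔞 (abelianization ⋙ S (p ^ l)) 1 ≃+ ZMod p) ∧
      ∃ h : (extensionSeqGr p l).ShortExact,
        AddSubgroup.zmultiples (h.extClass : Ext 𝔞 (abelianization ⋙ S (p ^ l)) 1) = ⊤) :=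
  ⟨fun _ hd => bijective_mapExtAddHom hd, fun p l _ hl =>
    ⟨nonempty_ext_addEquiv_zmod p hl, extensionSeqGr_shortExact p l,
      zmultiples_extensionClass_eq_top p hl⟩⟩
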